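/- **Setting.** Let $\Psi_\infty$ be the set of completely monotone Archimedean generators: continuous $\psi:[0,\infty]\to[0,1]$ with $\psi(0)=1$, $\psi(\infty)=\lim_{t\to\infty}\psi(t)=0$ and $(-1)^k\psi^{(k)}(t)\ge 0$ for all $k\ge 0$, $t\in(0,\infty)$. The Archimedean copula generated by $\psi$ is $(x_1,\dots,x_m)\mapsto\psi\bigl(\psi^{-1}(x_1)+\dots+\psi^{-1}(x_m)\bigr)$. Let $d_1\ge 1$, $d_{1s_2}\ge 1$ for $s_2\in\{1,\dots,d_1\}$, and $d_{1s_2s_3}\ge 1$ for $s_3\in\{1,\dots,d_{1s_2}\}$. Put $d_{1s_2\cdot}=\sum_{s_3}d_{1s_2s_3}$ and $d=\sum_{s_2}d_{1s_2\cdot}$. Let $\psi_1,\psi_{1s_2},\psi_{1s_2s_3}\in\Psi_\infty$ be such that the nodes $\mathring\psi_{1,1s_2}=\psi_1^{-1}\circ\psi_{1s_2}$ and $\mathring\psi_{1s_2,1s_2s_3}=\psi_{1s_2}^{-1}\circ\psi_{1s_2s_3}$ all have completely monotone first derivatives on $(0,\infty)$. Let $C_1,C_{1s_2},C_{1s_2s_3}$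 be the Archimedean copulas of dimensions $d_1,d_{1s_2},d_{1s_2s_3}$ generated by these generators, and $$C_{1s_2}^*(u_{1s_2})=C_{1s_2}\bigl(C_{1s_21}(u_{1s_21}),\dots,C_{1s_2d_{1s_2}}(u_{1s_2d_{1s_2}})\bigr),\qquad C(u)=C_1\bigl(C^*_{11}(u_{11}),\dots,C^*_{1d_1}(u_{1d_1})\bigr),$$ where $u_{1s_2s_3}=(u_{1s_2s_31},\dots,u_{1s_2s_3d_{1s_2s_3}})$, $u_{1s_2}=(u_{1s_21},\dots,u_{1s_2d_{1s_2}})$ and $u=(u_{11},\dots,u_{1d_1})\in[0,1]^d$. Put $$t_{1s_2s_3}(u_{1s_2s_3})=\sum_{s_4=1}^{d_{1s_2s_3}}\psi_{1s_2s_3}^{-1}(u_{1s_2s_3s_4}),\quad \mathbf t_{1s_2}(u_{1s_2})=\bigl(t_{1s_2s_3}(u_{1s_2s_3})\bigr)_{s_3},\quad t^*_{1s_2}(u_{1s_2})=\psi_{1s_2}^{-1}\bigl(C^*_{1s_2}(u_{1s_2})\bigr)=\sum_{s_3}\mathring\psi_{1s_2,1s_2s_3}\bigl(t_{1s_2s_3}(u_{1s_2s_3})\bigr),$$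 $\mathbf t(u)=(\mathbf t_{1s_2}(u_{1s_2}))_{s_2}$, $t(u)=\psi_1^{-1}(C(u))$, and, for $v>0$, let $\psi_{1,1s_2}(t;v)=\exp\bigl(-v\,\mathring\psi_{1,1s_2}(t)\bigr)$ be the inner generator. Let $$B_{n,k}(x_1,\dots,x_{n-k+1})=\sum_{j}\frac{n!}{j_1!\cdots j_{n-k+1}!}\prod_{l=1}^{n-k+1}\Bigl(\frac{x_l}{l!}\Bigr)^{j_l}$$ be the Bell polynomial, the sum being over all $j\in\{0,1,2,\dots\}^{n-k+1}$ with $\sum_i i\,j_i=n$ and $\sum_i j_i=k$. For $\delta\in\{1,2,\dots\}^m$ let $\mathcal Q^m_{\delta,k}$ be the set of all $j\in\{1,2,\dots\}^m$ with $\sum_s j_s=k$ and $j_s\le\delta_s$ for all $s$. For $t>0$ let $a_{1s_2,lk}(t)=B_{l,k}\bigl(\mathring\psi_{1,1s_2}'(t),\dots,\mathring\psi_{1,1s_2}^{(l-k+1)}(t)\bigr)$, and with $\delta_{s_2}=(d_{1s_21},\dots,d_{1s_2d_{1s_2}})$ put $$a_{1s_2,d_{1s_2\cdot}k}\bigl(\mathbf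 t_{1s_2}(u_{1s_2})\bigr)=\sum_{l=k}^{d_{1s_2\cdot}}a_{1s_2,lk}\bigl(t^*_{1s_2}(u_{1s_2})\bigr)\sum_{j\in\mathcal Q^{d_{1s_2}}_{\delta_{s_2},l}}\ \prod_{s_3=1}^{d_{1s_2}}B_{d_{1s_2s_3},j_{s_3}}\Bigl(\bigl(\mathring\psi^{(r)}_{1s_2,1s_2s_3}(t_{1s_2s_3}(u_{1s_2s_3}))\bigr)_{1\le r\le d_{1s_2s_3}-j_{s_3}+1}\Bigr),$$ $$b_k(\mathbf t(u))=\sum_{j\in\mathcal Q^{d_1}_{(d_{11\cdot},\dots,d_{1d_1\cdot}),k}}\ \prod_{s_2=1}^{d_1}a_{1s_2,d_{1s_2\cdot}j_{s_2}}\bigl(\mathbf t_{1s_2}(u_{1s_2})\bigr).$$ **Statement.** (1) For every $s_2\in\{1,\dots,d_1\}$ and $v_1>0$, the function $u_{1s_2}\mapsto\psi_{1,1s_2}(t^*_{1s_2}(u_{1s_2});v_1)$ is smooth on $(0,1)^{d_{1s_2\cdot}}$, and its mixed partial derivative, taken once with respect to every component of $u_{1s_2}$ (in any order), is $$\frac{\partial}{\partial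 u_{1s_2}}\psi_{1,1s_2}\bigl(t^*_{1s_2}(u_{1s_2});v_1\bigr)=\Bigl(\prod_{s_3=1}^{d_{1s_2}}\prod_{s_4=1}^{d_{1s_2s_3}}(\psi^{-1}_{1s_2s_3})'(u_{1s_2s_3s_4})\Bigr)\,\psi_{1,1s_2}\bigl(t^*_{1s_2}(u_{1s_2});v_1\bigr)\sum_{k=1}^{d_{1s_2\cdot}}a_{1s_2,d_{1s_2\cdot}k}\bigl(\mathbf t_{1s_2}(u_{1s_2})\bigr)(-v_1)^k .$$ (2) $C$ is smooth on $(0,1)^d$ and has a probability density $c$, that is, $c\ge 0$ is integrable on $(0,1)^d$ and $C(u)=\int_{\prod(0,u_i)}c(x)\,dx$ for all $u\in[0,1]^d$. On $(0,1)^d$ this $c$ is the mixed partial derivative of $C$ with respect to all $d$ variables (in any order) and is given by $$c(u)=\Bigl(\prod_{s_2=1}^{d_1}\prod_{s_3=1}^{d_{1s_2}}\prod_{s_4=1}^{d_{1s_2s_3}}(\psi^{-1}_{1s_2s_3})'(u_{1s_2s_3s_4})\Bigr)\sum_{k=d_1}^{d}b_k(\mathbf t(u))\,\psi_1^{(k)}(t(u)).$$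 Moreover, if $F_1$ is a probability distribution on $(0,\infty)$ with Laplace–Stieltjes transform $\psi_1$, then $c(u)=\int_0^\infty\prod_{s_2=1}^{d_1}\frac{\partial}{\partial u_{1s_2}}\psi_{1,1s_2}\bigl(t^*_{1s_2}(u_{1s_2});v_1\bigr)\,dF_1(v_1)$ for $u\in(0,1)^d$, the integrand being integrable. -/

import Mathlib

open Set MeasureTheory Filter
open scoped Topology ContDiff Nat

noncomputable section

/-- `f` is completely monotone on `(0, ∞)`: it has derivatives of all orders there and
`(-1)^k f^{(k)} ≥ 0` for every `k ≥ 0`. -/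
structure IsCompletelyMonotone (f : ℝ → ℝ) : Prop where
  smooth : ContDiffOn ℝ ∞ f (Ioi 0)
  sign : ∀ (k : ℕ) (t : ℝ), 0 < t → 0 ≤ (-1) ^ k * iteratedDeriv k f t

/-- Completely monotone Archimedean generators. A generator is represented by a function on `ℝ` of
which only the values on `[0, ∞)` matter; the value at `∞` is the limit `0`. -/
structure IsGenerator (ψ : ℝ → ℝ) : Prop where
  continuousOn : ContinuousOn ψ (Ici 0)
  map_zero : ψ 0 = 1
  tendsto_zero : Tendsto ψ atTop (𝓝 0)
  completelyMonotone : IsCompletelyMonotone ψ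

/-- The inverse `ψ⁻¹ : (0, 1] → [0, ∞)` of a generator. (The conventions `ψ⁻¹(0) = ∞`, `ψ(∞) = 0` are
taken care of in `archCopula`.) -/
def genInv (ψ : ℝ → ℝ) (x : ℝ) : ℝ := Function.invFunOn ψ (Ici 0) x

/-- The node `ψ₀⁻¹ ∘ ψₛ`. -/
def node (ψ₀ ψₛ : ℝ → ℝ) (t : ℝ) : ℝ := genInv ψ₀ (ψₛ t)

/-- The inner generator `t ↦ exp (-v · (ψ₀⁻¹ ∘ ψₛ)(t))`. -/
def innerGenerator (ψ₀ ψₛ : ℝ → ℝ) (v t : ℝ) : ℝ := Real.exp (-v * node ψ₀ ψₛ t)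

open Classical in
/-- The Archimedean copula `x ↦ ψ (∑ i, ψ⁻¹ (x i))` on `[0, 1]^ι`. Since `ψ⁻¹(0) = ∞` and
`ψ(∞) = 0`, it vanishes as soon as one of its arguments is `0`. -/
def archCopula {ι : Type*} [Fintype ι] (ψ : ℝ → ℝ) (x : ι → ℝ) : ℝ :=
  if ∀ i, 0 < x i then ψ (∑ i, genInv ψ (x i)) else 0

/-- The two-level nested Archimedean copula `C₀(C₁(w₁), …, Cₘ(wₘ))`, where `Cₛ` has
dimension `δ s`. -/
def nestedCopula {m : ℕ} {δ : Fin m → ℕ} (ψ₀ : ℝ → ℝ) (ψ : Fin m → ℝ → ℝ)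
    (w : (Σ s : Fin m, Fin (δ s)) → ℝ) : ℝ :=
  archCopula ψ₀ fun s => archCopula (ψ s) fun j => w ⟨s, j⟩

/-- The three-level nested Archimedean copula. The argument `u ⟨s₂, s₃, s₄⟩` is the `s₄`-th
argument of the copula generated by `ψ₃ s₂ s₃`. -/
def nestedCopula₃ {d₁ : ℕ} {d₂ : Fin d₁ → ℕ} {d₃ : (s₂ : Fin d₁) → Fin (d₂ s₂) → ℕ}
    (ψ₁ : ℝ → ℝ) (ψ₂ : Fin d₁ → ℝ → ℝ) (ψ₃ : (s₂ : Fin d₁) → Fin (d₂ s₂) → ℝ → ℝ)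
    (u : (Σ s₂ : Fin d₁, Σ s₃ : Fin (d₂ s₂), Fin (d₃ s₂ s₃)) → ℝ) : ℝ :=
  archCopula ψ₁ fun s₂ => nestedCopula (ψ₂ s₂) (ψ₃ s₂) fun p => u ⟨s₂, p⟩

/-- `t*(w) = ψ₀⁻¹(C*(w))` for the two-level nested Archimedean copula `C*` with root
generator `ψ₀`. -/
def tStar {m : ℕ} {δ : Fin m → ℕ} (ψ₀ : ℝ → ℝ) (ψ : Fin m → ℝ → ℝ)
    (w : (Σ s : Fin m, Fin (δ s)) → ℝ) : ℝ :=
  genInv ψ₀ (nestedCopula ψ₀ ψ w)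

/-- The vector `𝐭(w)` with entries `tₛ(wₛ) = ∑ⱼ ψₛ⁻¹(wₛⱼ)`. -/
def tVec {m : ℕ} {δ : Fin m → ℕ} (ψ : Fin m → ℝ → ℝ) (w : (Σ s : Fin m, Fin (δ s)) → ℝ)
    (s : Fin m) : ℝ :=
  ∑ j : Fin (δ s), genInv (ψ s) (w ⟨s, j⟩)

/-- The index set of the Bell polynomial: all `j = (j₁, …, j_{n-k+1})` of nonnegative integers with
`∑ i jᵢ = n` and `∑ jᵢ = k`. The entry `jᵢ` is `j (i - 1)`; the bound `jᵢ ≤ n` only serves to make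
the set visibly finite, as it follows from `∑ i jᵢ = n`. -/
def bellIndex (n k : ℕ) : Finset (Fin (n - k + 1) → ℕ) :=
  (Fintype.piFinset fun _ => Finset.range (n + 1)).filter fun j =>
    ∑ i : Fin (n - k + 1), ((i : ℕ) + 1) * j i = n ∧ ∑ i, j i = k

/-- The partial Bell polynomial `B_{n,k}(x₁, …, x_{n-k+1})`. -/
def bell (n k : ℕ) (x : ℕ → ℝ) : ℝ :=
  ∑ j ∈ bellIndex n k,
    ((n ! : ℝ) / ∏ i, ((j i)! : ℝ)) *
      ∏ i : Fin (n - k + 1), (x ((i : ℕ) + 1) / (((i : ℕ) + 1)! : ℝ)) ^ j i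

/-- `𝒬^m_{δ,k}`: all `j ∈ {1, 2, …}^m` with `∑ₛ jₛ = k` and `jₛ ≤ δₛ`. -/
def cauchyIndex {m : ℕ} (δ : Fin m → ℕ) (k : ℕ) : Finset (Fin m → ℕ) :=
  (Fintype.piFinset fun s => Finset.Icc 1 (δ s)).filter fun j => ∑ s, j s = k

/-- One-variable coefficients `B_{n,k}(g'(t), …, g^{(n-k+1)}(t))` for the node `g = ψ₀⁻¹ ∘ ψₛ`. -/
def coeffNode (ψ₀ ψₛ : ℝ → ℝ) (n k : ℕ) (t : ℝ) : ℝ :=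
  bell n k fun r => iteratedDeriv r (node ψ₀ ψₛ) t

/-- The coefficient `a_{s₁s₂, n k}(𝐭)`, with `n = ∑ δ`, of a branch `s₁s₂` of the tree:
`ψ₁` is the root generator, `ψ₂` the generator of the branch, `ψ₃` the generators of its
children, `δ` their dimensions. -/
def coeffA {m : ℕ} (δ : Fin m → ℕ) (ψ₁ ψ₂ : ℝ → ℝ) (ψ₃ : Fin m → ℝ → ℝ) (k : ℕ)
    (t : Fin m → ℝ) : ℝ :=
  ∑ l ∈ Finset.Icc k (∑ s, δ s),
    coeffNode ψ₁ ψ₂ l k (∑ s, node ψ₂ (ψ₃ s) (t s)) *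
      ∑ j ∈ cauchyIndex δ l, ∏ s, coeffNode ψ₂ (ψ₃ s) (δ s) (j s) (t s)

/-- The coefficient `b_k(𝐭)`: the coefficient of order `k` of the Cauchy product of the polynomials
with coefficients `coeffA`. -/
def coeffB {d₁ : ℕ} {d₂ : Fin d₁ → ℕ} (d₃ : (s₂ : Fin d₁) → Fin (d₂ s₂) → ℕ)
    (ψ₁ : ℝ → ℝ) (ψ₂ : Fin d₁ → ℝ → ℝ) (ψ₃ : (s₂ : Fin d₁) → Fin (d₂ s₂) → ℝ → ℝ) (k : ℕ)
    (t : (s₂ : Fin d₁) → Fin (d₂ s₂) → ℝ) : ℝ :=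
  ∑ j ∈ cauchyIndex (fun s₂ => ∑ s₃, d₃ s₂ s₃) k,
    ∏ s₂, coeffA (d₃ s₂) ψ₁ (ψ₂ s₂) (ψ₃ s₂) (j s₂) (t s₂)

/-- The open unit cube `(0, 1)^ι`. -/
def openCube (ι : Type*) : Set (ι → ℝ) := {x | ∀ i, x i ∈ Ioo (0 : ℝ) 1}

/-- The partial derivative `∂f/∂xᵢ`. -/
def partialDeriv {ι : Type*} [DecidableEq ι] (i : ι) (f : (ι → ℝ) → ℝ) (x : ι → ℝ) : ℝ :=
  deriv (fun y => f (Function.update x i y)) (x i)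

/-- The iterated partial derivative with respect to the variables in the list `L`. -/
def iteratedPartial {ι : Type*} [DecidableEq ι] (L : List ι) (f : (ι → ℝ) → ℝ) :
    (ι → ℝ) → ℝ :=
  L.foldr partialDeriv f

/-- The list `L` contains every index exactly once. -/
def IsEnumeration {ι : Type*} (L : List ι) : Prop := L.Nodup ∧ ∀ i, i ∈ L

/-- On the open set `S`, `f` is smooth and its mixed partial derivative `∂f/∂x`, taken once with
respect to each variable, in whatever order, is `g`. -/
def HasMixedPartialOn {ι : Type*} [Fintype ι] [DecidableEq ι] (f g : (ι → ℝ) → ℝ)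
    (S : Set (ι → ℝ)) : Prop :=
  ContDiffOn ℝ ∞ f S ∧ ∀ L : List ι, IsEnumeration L → ∀ x ∈ S, iteratedPartial L f x = g x

/-- `c` is a probability density on `(0, 1)^ι` whose distribution function on `[0, 1]^ι` is `C`. -/
def IsDensityOf {ι : Type*} [Fintype ι] (c C : (ι → ℝ) → ℝ) : Prop :=
  (∀ u ∈ openCube ι, 0 ≤ c u) ∧ IntegrableOn c (openCube ι) ∧
    ∀ u : ι → ℝ, (∀ i, u i ∈ Icc (0 : ℝ) 1) →
      ∫ x in Set.univ.pi fun i => Ioo 0 (u i), c x = C u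

/-- The measure `F` is a probability distribution on `(0, ∞)` with Laplace–Stieltjes
transform `ψ`. -/
def IsLaplaceInverse (F : Measure ℝ) (ψ : ℝ → ℝ) : Prop :=
  IsProbabilityMeasure F ∧ F (Iic 0) = 0 ∧ ∀ t : ℝ, 0 ≤ t → ∫ v, Real.exp (-v * t) ∂F = ψ t

end

/-!
The idea is to differentiate along an arbitrary list `L` of distinct variables and to record the
result for all outer functions at once. For a function `T` of several variables, the expression
`P L = e^{-zT} ∂_L e^{zT}` is a polynomial in `z` with coefficients that are functions on the cube,
and `∂_L (h ∘ T) = ∑ k, [z^k] (P L) · h^{(k)} ∘ T` for every smooth `h`. The polynomials are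
determined by `P (i :: L) = ∂ᵢ (P L) + z (∂ᵢ T) (P L)`; this recursion is `IsBellFamily`, and
`IsBellFamily.iteratedPartial_comp` is the chain rule. As the recursion follows whatever list is
given, no symmetry of second derivatives is used.

The nested copula is built by three operations, and each of them acts on the polynomials.
* A sum `∑ ψ⁻¹(wⱼ)` over one leaf group gives the monomial `∏ (ψ⁻¹)'(wⱼ) · z^{|L|}`
  (`IsBellFamily.sum_apply`).
* Applying a node `g` replaces `z^l` by `∑ k, B_{l,k}(g', g'', …) z^k` (`IsBellFamily.comp`). This
  is Faà di Bruno's formula in the form `hasCoeffDerivAt_bellSeries`, and it comes from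
  `B_{n,k} = n!/k! [X^n] (∑ r ≥ 1, g^{(r)} X^r / r!)^k` (`bell_eq_coeff`, by the multinomial
  theorem).
* Adding functions of disjoint groups of variables multiplies the polynomials
  (`IsBellFamily.sum_blocks`); the coefficients of the product are the sums over `cauchyIndex`.

Running through the tree yields `coeffA` after two levels and `coeffB` after three. With
`h = exp (-v ·)` this gives the derivatives of the inner generators, with `h = ψ₁` the density. The
mixture representation holds because the product of the former is `e^{-v t(u)}` times a polynomial
in `-v` with coefficients proportional to `coeffB`, and `ψ₁^{(k)}(t) = ∫ (-v)^k e^{-vt} dF(v)`.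

For all this the generators have to be positive with nonvanishing derivative, so that `ψ⁻¹` is
smooth. Positivity is the fact that a completely monotone function with a zero vanishes identically,
proved by comparing Taylor expansions (`IsCompletelyMonotone.eq_zero_of_eq_zero`).

Finally, the mixed partial derivative is nonnegative since all signs cancel
(`nestedDensity_nonneg`), and it integrates to the copula: over a box inside the open cube its
integral is the iterated difference of the copula (`setLIntegral_box_eq`), and as the lower corner
tends to the origin all terms but one vanish because the copula is bounded by each of its arguments
(`isDensityOf_of_iteratedPartial`).
-/

/-! ### Iterated derivatives on the half-line -/

theorem contDiffOn_iteratedDeriv {g : ℝ → ℝ} (hg : ContDiffOn ℝ ∞ g (Ioi 0)) (r : ℕ) :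
    ContDiffOn ℝ ∞ (iteratedDeriv r g) (Ioi 0) := by
  induction r with
  | zero => simpa using hg
  | succ r ih =>
    rw [iteratedDeriv_succ]
    exact ih.deriv_of_isOpen isOpen_Ioi (by simp)

theorem hasDerivAt_iteratedDeriv {g : ℝ → ℝ} (hg : ContDiffOn ℝ ∞ g (Ioi 0)) (r : ℕ) {t : ℝ}
    (ht : 0 < t) : HasDerivAt (iteratedDeriv r g) (iteratedDeriv (r + 1) g t) t := by
  rw [iteratedDeriv_succ]
  exact (((contDiffOn_iteratedDeriv hg r).contDiffAt (Ioi_mem_nhds ht)).differentiableAt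
    (by simp)).hasDerivAt

/-! ### Coefficientwise derivatives of power series -/

/-- The coefficients of the power series `p y` are differentiable in `y` at `t`, and their
derivatives are the coefficients of `q`. -/
def HasCoeffDerivAt (p : ℝ → PowerSeries ℝ) (q : PowerSeries ℝ) (t : ℝ) : Prop :=
  ∀ k, HasDerivAt (fun y => PowerSeries.coeff k (p y)) (PowerSeries.coeff k q) t

namespace HasCoeffDerivAt

variable {p p₁ p₂ : ℝ → PowerSeries ℝ} {q q₁ q₂ : PowerSeries ℝ} {t : ℝ}

theorem const (q : PowerSeries ℝ) (t : ℝ) : HasCoeffDerivAt (fun _ => q) 0 t := fun k => by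
  simpa using hasDerivAt_const t (PowerSeries.coeff k q)

theorem C {f : ℝ → ℝ} {f' : ℝ} (hf : HasDerivAt f f' t) :
    HasCoeffDerivAt (fun y => PowerSeries.C (f y)) (PowerSeries.C f') t := fun k => by
  rcases eq_or_ne k 0 with rfl | hk
  · simpa using hf
  · simpa [PowerSeries.coeff_C, hk] using hasDerivAt_const t (0 : ℝ)

theorem mul (h₁ : HasCoeffDerivAt p₁ q₁ t) (h₂ : HasCoeffDerivAt p₂ q₂ t) :
    HasCoeffDerivAt (fun y => p₁ y * p₂ y) (q₁ * p₂ t + p₁ t * q₂) t := fun k => by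
  simp only [PowerSeries.coeff_mul, map_add, ← Finset.sum_add_distrib]
  exact HasDerivAt.fun_sum fun a _ => (h₁ a.1).mul (h₂ a.2)

theorem sum {ι : Type*} {s : Finset ι} {p : ι → ℝ → PowerSeries ℝ} {q : ι → PowerSeries ℝ}
    (h : ∀ i ∈ s, HasCoeffDerivAt (p i) (q i) t) :
    HasCoeffDerivAt (fun y => ∑ i ∈ s, p i y) (∑ i ∈ s, q i) t := fun k => by
  simp only [map_sum]
  exact HasDerivAt.fun_sum fun i hi => h i hi k

theorem pow (h : HasCoeffDerivAt p q t) (n : ℕ) :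
    HasCoeffDerivAt (fun y => p y ^ (n + 1)) ((n + 1 : ℕ) * p t ^ n * q) t := by
  induction n with
  | zero => simpa using h
  | succ n ih =>
    have := ih.mul h
    simp only [pow_succ _ (n + 1)]
    convert! this using 1
    push_cast
    ring

theorem comp {f : ℝ → ℝ} {f' : ℝ} (h : HasCoeffDerivAt p q (f t)) (hf : HasDerivAt f f' t) :
    HasCoeffDerivAt (fun y => p (f y)) (PowerSeries.C f' * q) t := fun k => by
  rw [PowerSeries.coeff_C_mul, mul_comm]
  exact (h k).comp t hf

end HasCoeffDerivAt

/-! ### Bell polynomials -/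

/-- The exponential generating series `∑ r ≥ 1, x r / r! * X ^ r` of a sequence, without its
constant term. -/
noncomputable def jetSeries (x : ℕ → ℝ) : PowerSeries ℝ :=
  PowerSeries.mk fun r => if r = 0 then 0 else x r / (r ! : ℝ)

/-- The Bell polynomials `B_{n,k}(x)` for fixed `n`, as the coefficients of a series in the
formal variable that counts `k`. -/
noncomputable def bellSeries (n : ℕ) (x : ℕ → ℝ) : PowerSeries ℝ :=
  PowerSeries.mk fun k => bell n k x

theorem X_dvd_jetSeries (x : ℕ → ℝ) : PowerSeries.X ∣ jetSeries x := by
  rw [PowerSeries.X_dvd_iff]; simp [jetSeries, ← PowerSeries.coeff_zero_eq_constantCoeff_apply]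

/-- Only the first `n - k + 1` terms of the generating series enter the coefficient of order `n`
of its `k`-th power. -/
theorem coeff_jetSeries_pow (n k : ℕ) (x : ℕ → ℝ) :
    PowerSeries.coeff n (jetSeries x ^ k) =
      PowerSeries.coeff n ((∑ i : Fin (n - k + 1),
        PowerSeries.monomial ((i : ℕ) + 1) (x ((i : ℕ) + 1) / (((i : ℕ) + 1)! : ℝ))) ^ k) := by
  set Q : PowerSeries ℝ := ∑ i : Fin (n - k + 1),
    PowerSeries.monomial ((i : ℕ) + 1) (x ((i : ℕ) + 1) / (((i : ℕ) + 1)! : ℝ)) with hQ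
  have hQc : ∀ r, PowerSeries.coeff r Q = if r = 0 ∨ n - k + 1 < r then 0 else x r / (r ! : ℝ) := by
    intro r
    simp only [hQ, map_sum, PowerSeries.coeff_monomial]
    rcases r with _ | r
    · simp
    · simp only [Nat.add_right_cancel_iff, Nat.succ_ne_zero, false_or]
      split_ifs with h
      · exact Finset.sum_eq_zero fun i _ => if_neg (by have := i.2; omega)
      · rw [Finset.sum_eq_single (⟨r, by omega⟩ : Fin (n - k + 1))]
        · simp
        · intro i _ hi
          exact if_neg fun h' => hi (Fin.ext h'.symm)
        · simp
  have hXQ : PowerSeries.X ∣ Q := by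
    rw [PowerSeries.X_dvd_iff, ← PowerSeries.coeff_zero_eq_constantCoeff_apply, hQc]; simp
  have hdiff : PowerSeries.X ^ (n - k + 2) ∣ jetSeries x - Q := by
    rw [PowerSeries.X_pow_dvd_iff]
    intro r hr
    rw [map_sub, hQc, jetSeries, PowerSeries.coeff_mk]
    rcases eq_or_ne r 0 with rfl | h0
    · simp
    · rw [if_neg h0, if_neg (by omega), sub_self]
  rcases k with _ | k
  · simp
  have hdvd : PowerSeries.X ^ (n + 1) ∣ jetSeries x ^ (k + 1) - Q ^ (k + 1) := by
    rw [← Commute.geom_sum₂_mul (Commute.all _ _), mul_comm]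
    have h2 : PowerSeries.X ^ k ∣
        ∑ i ∈ Finset.range (k + 1), jetSeries x ^ i * Q ^ (k + 1 - 1 - i) := by
      refine Finset.dvd_sum fun i hi => ?_
      have hik : k = i + (k + 1 - 1 - i) := by have := Finset.mem_range.1 hi; omega
      have := mul_dvd_mul (pow_dvd_pow_of_dvd (X_dvd_jetSeries x) i)
        (pow_dvd_pow_of_dvd hXQ (k + 1 - 1 - i))
      rwa [← pow_add, ← hik] at this
    refine (pow_dvd_pow _ (?_ : n + 1 ≤ n - (k + 1) + 2 + k)).trans
      (pow_add (PowerSeries.X : PowerSeries ℝ) _ _ ▸ mul_dvd_mul hdiff h2)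
    omega
  have := (PowerSeries.X_pow_dvd_iff.1 hdvd) n (Nat.lt_succ_self n)
  rwa [map_sub, sub_eq_zero] at this

theorem bell_eq_coeff (n k : ℕ) (x : ℕ → ℝ) :
    bell n k x = (n ! : ℝ) / (k ! : ℝ) * PowerSeries.coeff n (jetSeries x ^ k) := by
  rw [coeff_jetSeries_pow, Finset.sum_pow_eq_sum_piAntidiag, map_sum, Finset.mul_sum]
  have hmon : ∀ j : Fin (n - k + 1) → ℕ,
      (∏ i : Fin (n - k + 1), PowerSeries.monomial ((i : ℕ) + 1)
        (x ((i : ℕ) + 1) / (((i : ℕ) + 1)! : ℝ)) ^ j i) =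
      PowerSeries.monomial (∑ i : Fin (n - k + 1), ((i : ℕ) + 1) * j i)
        (∏ i : Fin (n - k + 1), (x ((i : ℕ) + 1) / (((i : ℕ) + 1)! : ℝ)) ^ j i) := by
    intro j
    simp only [PowerSeries.monomial_pow, PowerSeries.prod_monomial, mul_comm (j _)]
  have hset : bellIndex n k = (Finset.piAntidiag Finset.univ k).filter
      fun j : Fin (n - k + 1) → ℕ => ∑ i : Fin (n - k + 1), ((i : ℕ) + 1) * j i = n := by
    ext j
    simp only [bellIndex, Finset.mem_filter, Fintype.mem_piFinset, Finset.mem_range,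
      Finset.mem_piAntidiag, Finset.mem_univ, implies_true, and_true]
    refine ⟨fun h => ⟨h.2.2, h.2.1⟩, fun h => ⟨fun i => ?_, h.2, h.1⟩⟩
    have h1 := Finset.single_le_sum (f := fun i : Fin (n - k + 1) => ((i : ℕ) + 1) * j i)
      (fun _ _ => Nat.zero_le _) (Finset.mem_univ i)
    have h2 : j i ≤ ((i : ℕ) + 1) * j i := Nat.le_mul_of_pos_left _ (Nat.succ_pos _)
    simp only [h.2] at h1
    omega
  unfold bell
  rw [hset, Finset.sum_filter]
  refine Finset.sum_congr rfl fun j hj => ?_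
  have hjk : ∑ i, j i = k := by simpa using hj
  rw [hmon, ← map_natCast (PowerSeries.C (R := ℝ)), PowerSeries.coeff_C_mul,
    PowerSeries.coeff_monomial]
  have hm : ((Nat.multinomial Finset.univ j : ℕ) : ℝ) = (k ! : ℝ) / ∏ i, ((j i)! : ℝ) := by
    have := Nat.multinomial_spec Finset.univ j
    rw [hjk] at this
    rw [eq_div_iff (by positivity), ← this]
    push_cast
    ring
  have hk : (k ! : ℝ) ≠ 0 := by positivity
  simp only [eq_comm (a := n)]
  split_ifs
  · rw [hm]; field_simp
  · simp

theorem bell_eq_zero_of_lt {n k : ℕ} (h : n < k) (x : ℕ → ℝ) : bell n k x = 0 := by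
  rw [bell_eq_coeff, PowerSeries.X_pow_dvd_iff.1 (pow_dvd_pow_of_dvd (X_dvd_jetSeries x) k) n h,
    mul_zero]

theorem bell_zero_right {n : ℕ} (h : n ≠ 0) (x : ℕ → ℝ) : bell n 0 x = 0 := by
  rw [bell_eq_coeff, pow_zero, PowerSeries.coeff_one, if_neg h, mul_zero]

theorem bellSeries_zero (x : ℕ → ℝ) : bellSeries 0 x = 1 := by
  ext k
  rw [bellSeries, PowerSeries.coeff_mk, PowerSeries.coeff_one]
  split_ifs with h
  · subst h; simp [bell_eq_coeff]
  · exact bell_eq_zero_of_lt (Nat.pos_of_ne_zero h) x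

/-- The derivative of the generating series of the jet of `g` is its formal derivative, up to the
constant term. -/
theorem hasCoeffDerivAt_jetSeries {g : ℝ → ℝ} (hg : ContDiffOn ℝ ∞ g (Ioi 0)) {t : ℝ}
    (ht : 0 < t) :
    HasCoeffDerivAt (fun y => jetSeries fun r => iteratedDeriv r g y)
      (PowerSeries.derivative ℝ (jetSeries fun r => iteratedDeriv r g t) -
        PowerSeries.C (deriv g t)) t := by
  intro k
  rw [map_sub, PowerSeries.coeff_derivative]
  simp only [jetSeries, PowerSeries.coeff_mk, PowerSeries.coeff_C]
  rcases k with _ | k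
  · simpa [iteratedDeriv_one] using hasDerivAt_const t (0 : ℝ)
  · simp only [Nat.succ_ne_zero, if_false, sub_zero]
    convert! (hasDerivAt_iteratedDeriv hg (k + 1) ht).div_const ((k + 1)! : ℝ) using 1
    rw [Nat.factorial_succ (k + 1)]
    push_cast
    field_simp

/-- The recursion for Bell polynomials along the jet of `g`: it is the coefficientwise form of
`e^{-zg} (e^{zg})^{(n+1)} = (∂ + z g') (e^{-zg} (e^{zg})^{(n)})`. -/
theorem hasCoeffDerivAt_bellSeries {g : ℝ → ℝ} (hg : ContDiffOn ℝ ∞ g (Ioi 0)) {t : ℝ}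
    (ht : 0 < t) (n : ℕ) :
    HasCoeffDerivAt (fun y => bellSeries n fun r => iteratedDeriv r g y)
      ((bellSeries (n + 1) fun r => iteratedDeriv r g t) -
        PowerSeries.C (deriv g t) * PowerSeries.X *
          bellSeries n fun r => iteratedDeriv r g t) t := by
  intro k
  have hJ := hasCoeffDerivAt_jetSeries hg ht
  rw [map_sub, mul_assoc, PowerSeries.coeff_C_mul]
  rcases k with _ | k
  · simp only [bellSeries, PowerSeries.coeff_mk, PowerSeries.coeff_zero_X_mul, mul_zero, sub_zero,
      bell_zero_right n.succ_ne_zero]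
    simp only [bell_eq_coeff, pow_zero]
    exact hasDerivAt_const _ _
  · rw [PowerSeries.coeff_succ_X_mul]
    simp only [bellSeries, PowerSeries.coeff_mk, bell_eq_coeff]
    have h := (hJ.pow k n).const_mul ((n ! : ℝ) / ((k + 1)! : ℝ))
    refine h.congr_deriv ?_
    set J := jetSeries fun r => iteratedDeriv r g t
    have hpow : ((k + 1 : ℕ) : PowerSeries ℝ) * J ^ k * PowerSeries.derivative ℝ J =
        PowerSeries.derivative ℝ (J ^ (k + 1)) := by
      have := (PowerSeries.derivative ℝ).leibniz_pow J (k + 1)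
      simp only [Nat.add_sub_cancel, nsmul_eq_mul, smul_eq_mul] at this
      rw [mul_assoc]; exact this.symm
    rw [mul_sub, hpow, map_sub, PowerSeries.coeff_derivative, mul_comm _ (PowerSeries.C _),
      PowerSeries.coeff_C_mul, ← map_natCast (PowerSeries.C (R := ℝ)), PowerSeries.coeff_C_mul,
      Nat.factorial_succ n, Nat.factorial_succ k]
    push_cast
    field_simp

/-- At a sequence of alternating signs the Bell polynomial has sign `(-1)^{n-k}`, written with
`n + k` to avoid truncated subtraction: `∑ i, (i - 1) jᵢ = n - k` for each of its monomials. -/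
theorem bell_sign (n k : ℕ) {x : ℕ → ℝ} (hx : ∀ r, 0 ≤ (-1) ^ r * x (r + 1)) :
    0 ≤ (-1) ^ (n + k) * bell n k x := by
  rw [bell, Finset.mul_sum]
  refine Finset.sum_nonneg fun j hj => ?_
  obtain ⟨-, h1, h2⟩ := Finset.mem_filter.1 hj
  have hs : n + k = ∑ i : Fin (n - k + 1), ((i : ℕ) + 2) * j i := by
    conv_lhs => rw [← h2]
    refine (congrArg (· + _) h1.symm).trans ?_
    rw [← Finset.sum_add_distrib]
    exact Finset.sum_congr rfl fun i _ => by ring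
  have : (-1 : ℝ) ^ (n + k) = ∏ i : Fin (n - k + 1), ((-1 : ℝ) ^ (i : ℕ)) ^ j i := by
    rw [hs, ← Finset.prod_pow_eq_pow_sum]
    refine Finset.prod_congr rfl fun i _ => ?_
    rw [← pow_mul, add_mul, pow_add, pow_mul (-1 : ℝ) 2]; simp
  rw [this, mul_left_comm, ← Finset.prod_mul_distrib]
  refine mul_nonneg (by positivity) (Finset.prod_nonneg fun i _ => ?_)
  rw [← mul_pow, ← mul_div_assoc]
  exact pow_nonneg (div_nonneg (hx i) (by positivity)) _

/-! ### Mixed partial derivatives along a list of variables -/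

theorem update_mem_openCube {ι : Type*} [DecidableEq ι] {w : ι → ℝ} (hw : w ∈ openCube ι) (i : ι)
    {y : ℝ} (hy : y ∈ Ioo (0 : ℝ) 1) : Function.update w i y ∈ openCube ι := fun j => by
  rcases eq_or_ne j i with rfl | h
  · simpa using hy
  · simpa [h] using hw j

theorem eventually_update_mem_openCube {ι : Type*} [DecidableEq ι] {w : ι → ℝ}
    (hw : w ∈ openCube ι) (i : ι) : ∀ᶠ y in 𝓝 (w i), Function.update w i y ∈ openCube ι :=
  Filter.mem_of_superset (Ioo_mem_nhds (hw i).1 (hw i).2) fun _ => update_mem_openCube hw i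

/-- The series `P L` describe the mixed partial derivatives of functions of `T`:
`P L = e^{-zT} ∂_L e^{zT}`, as a polynomial in `z`, for every list `L` of distinct variables.
This is encoded by the recursion `P (i :: L) = ∂ᵢ (P L) + z (∂ᵢ T) (P L)` on the open unit cube. -/
structure IsBellFamily {ι : Type*} [DecidableEq ι] (T : (ι → ℝ) → ℝ)
    (P : List ι → (ι → ℝ) → PowerSeries ℝ) : Prop where
  nil : ∀ w ∈ openCube ι, P [] w = 1
  cons : ∀ (i : ι) (L : List ι), (i :: L).Nodup → ∀ w ∈ openCube ι, ∃ (τ : ℝ) (q : PowerSeries ℝ),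
    HasDerivAt (fun y => T (Function.update w i y)) τ (w i) ∧
    HasCoeffDerivAt (fun y => P L (Function.update w i y)) q (w i) ∧
    P (i :: L) w = q + PowerSeries.C τ * PowerSeries.X * P L w

namespace IsBellFamily

variable {ι : Type*} [DecidableEq ι] {T : (ι → ℝ) → ℝ} {P : List ι → (ι → ℝ) → PowerSeries ℝ}

theorem coeff_eq_zero (hP : IsBellFamily T P) {L : List ι} (hL : L.Nodup) {w : ι → ℝ}
    (hw : w ∈ openCube ι) {k : ℕ} (hk : L.length < k) : PowerSeries.coeff k (P L w) = 0 := by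
  induction L generalizing w k with
  | nil => rw [hP.nil w hw, PowerSeries.coeff_one, if_neg (by simp at hk; omega)]
  | cons i L ih =>
    obtain ⟨τ, q, -, hq, hcons⟩ := hP.cons i L hL w hw
    have hL' := (List.nodup_cons.1 hL).2
    rw [List.length_cons] at hk
    have hq0 : PowerSeries.coeff k q = 0 := by
      refine (hq k).unique ((hasDerivAt_const (w i) (0 : ℝ)).congr_of_eventuallyEq ?_)
      exact (eventually_update_mem_openCube hw i).mono fun y hy => ih hL' hy (by omega)
    obtain ⟨k, rfl⟩ : ∃ k', k = k' + 1 := ⟨k - 1, by omega⟩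
    rw [hcons, map_add, hq0, mul_assoc, PowerSeries.coeff_C_mul, PowerSeries.coeff_succ_X_mul,
      ih hL' hw (by omega), mul_zero, add_zero]

/-- The multivariate chain rule: mixed partial derivatives of `h ∘ T` for an arbitrary outer
function `h`. -/
theorem iteratedPartial_comp (hP : IsBellFamily T P) (hT : ∀ w ∈ openCube ι, 0 < T w)
    {h : ℝ → ℝ} (hh : ContDiffOn ℝ ∞ h (Ioi 0)) {L : List ι} (hL : L.Nodup) {w : ι → ℝ}
    (hw : w ∈ openCube ι) {n : ℕ} (hn : L.length ≤ n) :
    iteratedPartial L (fun w => h (T w)) w =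
      ∑ k ∈ Finset.range (n + 1), PowerSeries.coeff k (P L w) * iteratedDeriv k h (T w) := by
  induction L generalizing w n with
  | nil =>
    simp [iteratedPartial, hP.nil w hw, PowerSeries.coeff_one, Finset.sum_ite_eq']
  | cons i L ih =>
    obtain ⟨τ, q, hτ, hq, hcons⟩ := hP.cons i L hL w hw
    have hL' := (List.nodup_cons.1 hL).2
    obtain ⟨n, rfl⟩ : ∃ m, n = m + 1 := ⟨n - 1, by simp at hn; omega⟩
    have hn' : L.length ≤ n := by simpa using hn
    have hev : (fun y => iteratedPartial L (fun w => h (T w)) (Function.update w i y)) =ᶠ[𝓝 (w i)]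
        fun y => ∑ k ∈ Finset.range (n + 1), PowerSeries.coeff k (P L (Function.update w i y)) *
          iteratedDeriv k h (T (Function.update w i y)) :=
      (eventually_update_mem_openCube hw i).mono fun y hy => ih hL' hy hn'
    have hder : ∀ k, HasDerivAt (fun y => iteratedDeriv k h (T (Function.update w i y)))
        (iteratedDeriv (k + 1) h (T w) * τ) (w i) := fun k =>
      (hasDerivAt_iteratedDeriv hh k (hT w hw)).comp_of_eq (w i) hτ
        (by rw [Function.update_eq_self])
    have hsum := HasDerivAt.fun_sum (u := Finset.range (n + 1)) fun k _ => (hq k).mul (hder k)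
    change deriv (fun y => iteratedPartial L (fun w => h (T w)) (Function.update w i y)) (w i) = _
    rw [hev.deriv_eq]
    refine hsum.deriv.trans ?_
    simp only [Function.update_eq_self, hcons, map_add, mul_assoc, PowerSeries.coeff_C_mul,
      add_mul, Finset.sum_add_distrib]
    congr 1
    · rw [Finset.sum_range_succ _ (n + 1)]
      have hq0 : PowerSeries.coeff (n + 1) q = 0 := by
        refine (hq (n + 1)).unique ((hasDerivAt_const (w i) (0 : ℝ)).congr_of_eventuallyEq ?_)
        exact (eventually_update_mem_openCube hw i).mono fun y hy =>
          hP.coeff_eq_zero hL' hy (by omega)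
      rw [hq0, zero_mul, add_zero]
    · rw [Finset.sum_range_succ' _ (n + 1)]
      simp only [PowerSeries.coeff_succ_X_mul, PowerSeries.coeff_zero_X_mul, mul_zero, zero_mul,
        add_zero]
      exact Finset.sum_congr rfl fun k _ => by ring

/-- Within a single group of variables the inner function is additively separable, and every
differentiation contributes one factor. -/
theorem sum_apply [Fintype ι] {f : ℝ → ℝ} (hf : DifferentiableOn ℝ f (Ioo 0 1)) :
    IsBellFamily (fun w : ι → ℝ => ∑ i, f (w i))
      (fun L w => PowerSeries.C (L.map fun i => deriv f (w i)).prod * PowerSeries.X ^ L.length) where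
  nil w _ := by simp
  cons i L hL w hw := by
    have hd : HasDerivAt f (deriv f (w i)) (w i) :=
      (hf.differentiableAt (Ioo_mem_nhds (hw i).1 (hw i).2)).hasDerivAt
    refine ⟨deriv f (w i), 0, ?_, ?_, ?_⟩
    · have := HasDerivAt.fun_sum (u := Finset.univ) (x := w i)
        (A := fun j y => f (Function.update w i y j))
        (A' := fun j => if j = i then deriv f (w i) else 0) fun j _ => by
          rcases eq_or_ne j i with rfl | h
          · simpa using hd
          · simpa [h] using hasDerivAt_const (w i) (f (w j))
      simpa using this
    · have hmap : ∀ y, (L.map fun j => deriv f (Function.update w i y j)) =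
          L.map fun j => deriv f (w j) := fun y => List.map_congr_left fun j hj => by
        rw [Function.update_of_ne (ne_of_mem_of_not_mem hj (List.nodup_cons.1 hL).1)]
      simp only [hmap]
      exact HasCoeffDerivAt.const _ _
    · simp only [List.map_cons, List.prod_cons, List.length_cons, pow_succ, map_mul]
      ring

/-- Faà di Bruno's formula: composing `T` with a function `g` of one variable. -/
theorem comp (hP : IsBellFamily T P) (hT : ∀ w ∈ openCube ι, 0 < T w) {g : ℝ → ℝ}
    (hg : ContDiffOn ℝ ∞ g (Ioi 0)) :
    IsBellFamily (fun w => g (T w)) (fun L w => ∑ l ∈ Finset.range (L.length + 1),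
      PowerSeries.C (PowerSeries.coeff l (P L w)) *
        bellSeries l fun r => iteratedDeriv r g (T w)) where
  nil w hw := by simp [hP.nil w hw, bellSeries_zero]
  cons i L hL w hw := by
    obtain ⟨τ, q, hτ, hq, hcons⟩ := hP.cons i L hL w hw
    have hL' := (List.nodup_cons.1 hL).2
    have hgd : HasDerivAt g (deriv g (T w)) (T w) := by
      simpa [iteratedDeriv_one] using hasDerivAt_iteratedDeriv hg 0 (hT w hw)
    have hTw : T (Function.update w i (w i)) = T w := by rw [Function.update_eq_self]
    have hB : ∀ l, HasCoeffDerivAt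
        (fun y => bellSeries l fun r => iteratedDeriv r g (T (Function.update w i y))) _ (w i) :=
      fun l => HasCoeffDerivAt.comp (p := fun x => bellSeries l fun r => iteratedDeriv r g x)
        (by rw [hTw]; exact hasCoeffDerivAt_bellSeries hg (hT w hw) l) hτ
    refine ⟨deriv g (T w) * τ, _, ?_, HasCoeffDerivAt.sum fun l _ =>
      (HasCoeffDerivAt.C (hq l)).mul (hB l), ?_⟩
    · exact hgd.comp_of_eq (w i) hτ hTw.symm
    · have hq0 : PowerSeries.coeff (L.length + 1) q = 0 := by
        refine (hq _).unique ((hasDerivAt_const (w i) (0 : ℝ)).congr_of_eventuallyEq ?_)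
        exact (eventually_update_mem_openCube hw i).mono fun y hy =>
          hP.coeff_eq_zero hL' hy (Nat.lt_succ_self _)
      simp only [Function.update_eq_self, List.length_cons, hcons, map_add, mul_assoc,
        PowerSeries.coeff_C_mul, add_mul, Finset.sum_add_distrib]
      rw [Finset.sum_range_succ _ (L.length + 1), hq0, Finset.sum_range_succ' _ (L.length + 1)]
      simp only [PowerSeries.coeff_succ_X_mul, PowerSeries.coeff_zero_X_mul, mul_zero, zero_mul,
        add_zero, map_zero, add_assoc]
      congr 1
      simp only [Finset.mul_sum, ← Finset.sum_add_distrib, map_mul]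
      exact Finset.sum_congr rfl fun l _ => by ring

end IsBellFamily

/-- The entries of the list `L` that lie in block `s`, as indices within that block. -/
noncomputable def blockList {σ : Type*} [DecidableEq σ] {κ : σ → Type*} (s : σ) (L : List (Σ s, κ s)) :
    List (κ s) :=
  L.filterMap fun p => if h : p.1 = s then some (h ▸ p.2) else none

section blockList

variable {σ : Type*} [DecidableEq σ] {κ : σ → Type*}

theorem blockList_cons_self (s : σ) (j : κ s) (L : List (Σ s, κ s)) :
    blockList s (⟨s, j⟩ :: L) = j :: blockList s L := by simp [blockList]

theorem blockList_cons_of_ne {s s' : σ} (h : s ≠ s') (j : κ s) (L : List (Σ s, κ s)) :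
    blockList s' (⟨s, j⟩ :: L) = blockList s' L := by simp [blockList, h]

theorem mem_blockList {s : σ} {j : κ s} {L : List (Σ s, κ s)} :
    j ∈ blockList s L ↔ (⟨s, j⟩ : Σ s, κ s) ∈ L := by
  induction L with
  | nil => simp [blockList]
  | cons p L ih =>
    obtain ⟨s', j'⟩ := p
    rcases eq_or_ne s' s with rfl | h
    · simp [blockList_cons_self, ih]
    · simp [blockList_cons_of_ne h, ih, h.symm]

theorem nodup_blockList {L : List (Σ s, κ s)} (hL : L.Nodup) (s : σ) : (blockList s L).Nodup := by
  induction L with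
  | nil => simp [blockList]
  | cons p L ih =>
    obtain ⟨s', j'⟩ := p
    rw [List.nodup_cons] at hL
    rcases eq_or_ne s' s with rfl | h
    · rw [blockList_cons_self, List.nodup_cons, mem_blockList]
      exact ⟨hL.1, ih hL.2⟩
    · rw [blockList_cons_of_ne h]
      exact ih hL.2

theorem IsEnumeration.blockList {L : List (Σ s, κ s)} (hL : IsEnumeration L) (s : σ) :
    IsEnumeration (blockList s L) :=
  ⟨nodup_blockList hL.1 s, fun _ => mem_blockList.2 (hL.2 _)⟩

end blockList

theorem IsEnumeration.length_eq {ι : Type*} [Fintype ι] {L : List ι} (hL : IsEnumeration L) :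
    L.length = Fintype.card ι := by
  classical
  rw [← List.toFinset_card_of_nodup hL.1, ← Finset.card_univ]
  congr 1
  ext i
  simp [hL.2 i]

theorem IsEnumeration.prod_map {ι : Type*} [Fintype ι] {L : List ι} (hL : IsEnumeration L)
    (f : ι → ℝ) : (L.map f).prod = ∏ i, f i := by
  classical
  rw [← List.prod_toFinset f hL.1]
  congr 1
  ext i
  simp [hL.2 i]

theorem exists_isEnumeration (ι : Type*) [Fintype ι] : ∃ L : List ι, IsEnumeration L :=
  ⟨Finset.univ.toList, Finset.nodup_toList _, fun i => by simp⟩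

/-- For a sum over disjoint groups of variables the series multiply, whatever the order in which
the groups are interleaved in the list. -/
theorem IsBellFamily.sum_blocks {σ : Type*} [Fintype σ] [DecidableEq σ] {κ : σ → Type*}
    [∀ s, DecidableEq (κ s)] {T : (s : σ) → (κ s → ℝ) → ℝ}
    {P : (s : σ) → List (κ s) → (κ s → ℝ) → PowerSeries ℝ} (hP : ∀ s, IsBellFamily (T s) (P s)) :
    IsBellFamily (fun w : (Σ s, κ s) → ℝ => ∑ s, T s fun j => w ⟨s, j⟩)
      (fun L w => ∏ s, P s (blockList s L) fun j => w ⟨s, j⟩) where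
  nil w hw := Finset.prod_eq_one fun s _ => (hP s).nil _ fun j => hw ⟨s, j⟩
  cons p L hL w hw := by
    obtain ⟨s, j⟩ := p
    have hLs : (j :: blockList s L).Nodup := by
      rw [← blockList_cons_self]; exact nodup_blockList hL s
    obtain ⟨τ, q, hτ, hq, hcons⟩ := (hP s).cons j (blockList s L) hLs (fun j => w ⟨s, j⟩)
      fun j => hw ⟨s, j⟩
    have hup : ∀ y, (fun j' => Function.update w ⟨s, j⟩ y ⟨s, j'⟩) =
        Function.update (fun j' => w ⟨s, j'⟩) j y := fun y => by
      funext j'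
      simp [Function.update_apply]
    have hne : ∀ s', s' ≠ s → ∀ y, (fun j' => Function.update w ⟨s, j⟩ y ⟨s', j'⟩) =
        fun j' => w ⟨s', j'⟩ := fun s' h y => by
      funext j'
      rw [Function.update_of_ne]
      exact fun h' => h (congrArg Sigma.fst h')
    refine ⟨τ, q * ∏ s' ∈ Finset.univ.erase s, P s' (blockList s' L) fun j => w ⟨s', j⟩,
      ?_, ?_, ?_⟩
    · have hT : (fun y => ∑ s', T s' fun j' => Function.update w ⟨s, j⟩ y ⟨s', j'⟩) = fun y =>
          T s (Function.update (fun j' => w ⟨s, j'⟩) j y) +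
            ∑ s' ∈ Finset.univ.erase s, T s' fun j' => w ⟨s', j'⟩ := by
        funext y
        rw [← Finset.add_sum_erase _ _ (Finset.mem_univ s), hup]
        congr 1
        exact Finset.sum_congr rfl fun s' hs' => by rw [hne s' (Finset.ne_of_mem_erase hs')]
      rw [hT]
      exact hτ.add_const _
    · have hPe : (fun y => ∏ s', P s' (blockList s' L)
          fun j' => Function.update w ⟨s, j⟩ y ⟨s', j'⟩) = fun y =>
          P s (blockList s L) (Function.update (fun j' => w ⟨s, j'⟩) j y) *
            ∏ s' ∈ Finset.univ.erase s, P s' (blockList s' L) fun j' => w ⟨s', j'⟩ := by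
        funext y
        rw [← Finset.mul_prod_erase _ _ (Finset.mem_univ s), hup]
        congr 1
        exact Finset.prod_congr rfl fun s' hs' => by rw [hne s' (Finset.ne_of_mem_erase hs')]
      rw [hPe]
      simpa using hq.mul (HasCoeffDerivAt.const _ _)
    · rw [← Finset.mul_prod_erase _ _ (Finset.mem_univ s),
        ← Finset.mul_prod_erase _ _ (Finset.mem_univ s), blockList_cons_self, hcons,
        Finset.prod_congr rfl fun s' hs' => by
          rw [blockList_cons_of_ne (Finset.ne_of_mem_erase hs').symm]]
      ring

/-! ### Completely monotone functions -/

namespace IsCompletelyMonotone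

variable {f : ℝ → ℝ}

theorem nonneg (hf : IsCompletelyMonotone f) {t : ℝ} (ht : 0 < t) : 0 ≤ f t := by
  simpa using hf.sign 0 t ht

theorem antitoneOn_iteratedDeriv (hf : IsCompletelyMonotone f) (k : ℕ) :
    AntitoneOn (fun t => (-1) ^ k * iteratedDeriv k f t) (Ioi 0) := by
  have hd : ∀ t ∈ Ioi (0 : ℝ), HasDerivAt (fun t => (-1) ^ k * iteratedDeriv k f t)
      ((-1) ^ k * iteratedDeriv (k + 1) f t) t := fun t ht =>
    (hasDerivAt_iteratedDeriv hf.smooth k ht).const_mul _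
  refine antitoneOn_of_deriv_nonpos (convex_Ioi 0)
    (fun t ht => (hd t ht).continuousAt.continuousWithinAt)
    (fun t ht => (hd t (interior_subset ht)).differentiableAt.differentiableWithinAt)
    fun t ht => ?_
  rw [(hd t (interior_subset ht)).deriv]
  have := hf.sign (k + 1) t (interior_subset ht)
  rw [pow_succ] at this
  linarith

theorem antitoneOn (hf : IsCompletelyMonotone f) : AntitoneOn f (Ioi 0) := by
  simpa using hf.antitoneOn_iteratedDeriv 0

/-- All terms of the Taylor expansion of a completely monotone function to the left are
nonnegative, so that each of them is at most the value of the function. -/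
theorem taylor_term_le (hf : IsCompletelyMonotone f) (n : ℕ) {a s : ℝ} (ha : 0 < a) (has : a < s) :
    (-1) ^ n * iteratedDeriv n f s * (s - a) ^ n / (n ! : ℝ) ≤ f a := by
  have hs : 0 < s := ha.trans has
  have hsub : uIcc s a ⊆ Ioi 0 := by
    rw [uIcc_of_ge has.le]; exact fun x hx => ha.trans_le hx.1
  obtain ⟨ξ, hξ, h⟩ := taylor_mean_remainder_lagrange_iteratedDeriv (n := n) has.ne'
    ((hf.smooth.of_le (by exact_mod_cast le_top)).mono hsub)
  rw [uIoo_of_ge has.le] at hξ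
  have hneg : ∀ (k : ℕ) (x : ℝ), x * (a - s) ^ k = (-1) ^ k * x * (s - a) ^ k := fun k x => by
    rw [← neg_sub s a, neg_pow]; ring
  have hrem : 0 ≤ iteratedDeriv (n + 1) f ξ * (a - s) ^ (n + 1) / ((n + 1)! : ℝ) := by
    rw [hneg]
    have := hf.sign (n + 1) ξ (ha.trans hξ.1)
    have : 0 ≤ s - a := by linarith
    positivity
  rw [← h, taylor_within_apply, sub_nonneg] at hrem
  refine le_trans ?_ hrem
  have hterm : ∀ k, ((k ! : ℝ)⁻¹ * (a - s) ^ k) • iteratedDerivWithin k f (uIcc s a) s =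
      (-1) ^ k * iteratedDeriv k f s * (s - a) ^ k / (k ! : ℝ) := fun k => by
    rw [iteratedDerivWithin_eq_iteratedDeriv (uniqueDiffOn_uIcc has.ne')
      ((hf.smooth.contDiffAt (Ioi_mem_nhds hs)).of_le (by exact_mod_cast le_top)) left_mem_uIcc,
      smul_eq_mul, ← hneg]
    ring
  simp only [hterm]
  refine Finset.single_le_sum (f := fun k => (-1) ^ k * iteratedDeriv k f s * (s - a) ^ k /
    (k ! : ℝ)) (fun k _ => ?_) (Finset.self_mem_range_succ n)
  have := hf.sign k s hs
  have : 0 ≤ s - a := by linarith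
  positivity

/-- If a completely monotone function vanishes near `t`, its Taylor expansion at `t` has only the
remainder, which tends to `0` at `3 t / 4`. -/
theorem eq_zero_of_eventuallyEq_zero (hf : IsCompletelyMonotone f) {t : ℝ} (ht : 0 < t)
    (h0 : f =ᶠ[𝓝 t] fun _ => 0) : f (3 / 4 * t) = 0 := by
  set s := 3 / 4 * t with hs
  have hs0 : 0 < s := by positivity
  have hst : s < t := by linarith
  have hsub : uIcc t s ⊆ Ioi 0 := by
    rw [uIcc_of_ge hst.le]; exact fun x hx => hs0.trans_le hx.1
  -- the remainder on `[s, t]` against the Taylor term at `s` seen from `t / 4`: `t - s` is half of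
  -- `s - t / 4`
  have hbound : ∀ n : ℕ, f s ≤ f (t / 4) * (1 / 2) ^ (n + 1) := by
    intro n
    obtain ⟨ξ, hξ, h⟩ := taylor_mean_remainder_lagrange_iteratedDeriv (n := n) hst.ne'
      ((hf.smooth.of_le (by exact_mod_cast le_top)).mono hsub)
    rw [uIoo_of_ge hst.le] at hξ
    have hT : taylorWithinEval f n (uIcc t s) t s = 0 := by
      rw [taylor_within_apply]
      refine Finset.sum_eq_zero fun k _ => ?_
      rw [iteratedDerivWithin_eq_iteratedDeriv (uniqueDiffOn_uIcc hst.ne')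
        ((hf.smooth.contDiffAt (Ioi_mem_nhds ht)).of_le (by exact_mod_cast le_top)) left_mem_uIcc,
        h0.iteratedDeriv_eq]
      simp
    rw [hT, sub_zero, ← neg_sub t s, neg_pow, mul_left_comm, ← mul_assoc] at h
    have h1 := hf.antitoneOn_iteratedDeriv (n + 1) (mem_Ioi.2 hs0) (hs0.trans hξ.1) hξ.1.le
    have h2 := hf.taylor_term_le (n + 1) (a := t / 4) (s := s) (by positivity) (by linarith)
    have h3 : (t - s) = (s - t / 4) * (1 / 2) := by rw [hs]; ring
    calc f s = (-1) ^ (n + 1) * iteratedDeriv (n + 1) f ξ * (t - s) ^ (n + 1) /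
          ((n + 1)! : ℝ) := h
      _ ≤ (-1) ^ (n + 1) * iteratedDeriv (n + 1) f s * (t - s) ^ (n + 1) / ((n + 1)! : ℝ) := by
          have : 0 ≤ t - s := by linarith
          simp only at h1
          gcongr
      _ = (-1) ^ (n + 1) * iteratedDeriv (n + 1) f s * (s - t / 4) ^ (n + 1) / ((n + 1)! : ℝ) *
          (1 / 2) ^ (n + 1) := by rw [h3, mul_pow]; ring
      _ ≤ _ := by gcongr
  have hlim : Tendsto (fun n : ℕ => f (t / 4) * (1 / 2 : ℝ) ^ (n + 1)) atTop (𝓝 0) := by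
    have := ((tendsto_pow_atTop_nhds_zero_of_lt_one (r := (1 / 2 : ℝ)) (by norm_num)
      (by norm_num)).comp (tendsto_add_atTop_nat 1)).const_mul (f (t / 4))
    simpa using this
  exact le_antisymm (ge_of_tendsto' hlim hbound) (hf.nonneg hs0)

/-- A completely monotone function with a zero vanishes identically: the zero set is an up-set of
`(0, ∞)` and contains a fixed fraction of each of its elements. -/
theorem eq_zero_of_eq_zero (hf : IsCompletelyMonotone f) {t : ℝ} (ht : 0 < t) (h0 : f t = 0)
    {s : ℝ} (hs : 0 < s) : f s = 0 := by
  have hup : ∀ {a b : ℝ}, 0 < a → f a = 0 → a ≤ b → f b = 0 := fun ha h hab =>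
    le_antisymm (h ▸ hf.antitoneOn ha (ha.trans_le hab) hab) (hf.nonneg (ha.trans_le hab))
  have hstep : ∀ a : ℝ, 0 < a → f a = 0 → f (4 / 5 * a) = 0 := by
    intro a ha h
    -- `3/4 * 16/15 = 4/5`, and the function vanishes near the point `16/15 * a` to the right of `a`
    have := hf.eq_zero_of_eventuallyEq_zero (t := 16 / 15 * a) (by positivity) <|
      (lt_mem_nhds (by linarith : a < 16 / 15 * a)).mono fun b hb => hup ha h hb.le
    convert this using 2
    ring
  have hpow : ∀ n : ℕ, f ((4 / 5) ^ n * t) = 0 := by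
    intro n
    induction n with
    | zero => simpa using h0
    | succ n ih =>
      have := hstep _ (by positivity) ih
      rwa [← mul_assoc, ← pow_succ'] at this
  obtain ⟨n, hn⟩ := exists_pow_lt_of_lt_one (div_pos hs ht) (by norm_num : (4 / 5 : ℝ) < 1)
  exact hup (by positivity) (hpow n) ((lt_div_iff₀ ht).1 hn).le

end IsCompletelyMonotone

/-! ### Generators, their inverses and nodes -/

namespace IsGenerator

variable {ψ ψ₀ : ℝ → ℝ}

theorem pos_of_pos (hψ : IsGenerator ψ) {t : ℝ} (ht : 0 < t) : 0 < ψ t := by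
  refine (hψ.completelyMonotone.nonneg ht).lt_of_ne fun h => ?_
  have h1 : Tendsto ψ (𝓝[>] 0) (𝓝 1) := by
    rw [← hψ.map_zero]
    exact (hψ.continuousOn 0 self_mem_Ici).mono Ioi_subset_Ici_self
  have h0 : Tendsto ψ (𝓝[>] 0) (𝓝 0) := tendsto_const_nhds.congr' <|
    eventually_mem_nhdsWithin.mono fun s hs =>
      (hψ.completelyMonotone.eq_zero_of_eq_zero ht h.symm hs).symm
  exact one_ne_zero (tendsto_nhds_unique h1 h0)

theorem pos (hψ : IsGenerator ψ) {t : ℝ} (ht : 0 ≤ t) : 0 < ψ t := by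
  rcases ht.eq_or_lt with rfl | ht
  · rw [hψ.map_zero]; exact one_pos
  · exact hψ.pos_of_pos ht

theorem hasDerivAt (hψ : IsGenerator ψ) {t : ℝ} (ht : 0 < t) : HasDerivAt ψ (deriv ψ t) t := by
  simpa [iteratedDeriv_one] using hasDerivAt_iteratedDeriv hψ.completelyMonotone.smooth 0 ht

/-- If the derivative vanished at `t`, then by convexity the generator would be constant from `t`
on, hence zero. -/
theorem deriv_neg (hψ : IsGenerator ψ) {t : ℝ} (ht : 0 < t) : deriv ψ t < 0 := by
  have hs : ∀ s, 0 < s → deriv ψ s ≤ 0 := fun s hs => by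
    simpa [iteratedDeriv_one] using hψ.completelyMonotone.sign 1 s hs
  refine (hs t ht).lt_of_ne fun h0 => ?_
  have hz : ∀ s, t ≤ s → 0 ≤ deriv ψ s := fun s hts => by
    have := hψ.completelyMonotone.antitoneOn_iteratedDeriv 1 (mem_Ioi.2 ht) (ht.trans_le hts) hts
    simpa [iteratedDeriv_one, h0] using this
  have hm : MonotoneOn ψ (Ici t) := by
    refine monotoneOn_of_deriv_nonneg (convex_Ici t)
      (hψ.continuousOn.mono (Ici_subset_Ici.2 ht.le)) (fun s hs' => ?_) fun s hs' => ?_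
    · exact (hψ.hasDerivAt (ht.trans_le (interior_subset hs'))).differentiableAt.differentiableWithinAt
    · exact hz s (interior_subset hs')
  have : ψ t ≤ 0 := ge_of_tendsto hψ.tendsto_zero <|
    (eventually_ge_atTop t).mono fun s hs' => hm self_mem_Ici hs' hs'
  exact (hψ.pos_of_pos ht).not_ge this

theorem strictAntiOn (hψ : IsGenerator ψ) : StrictAntiOn ψ (Ici 0) :=
  strictAntiOn_of_deriv_neg (convex_Ici 0) hψ.continuousOn fun t ht => by
    rw [interior_Ici] at ht; exact hψ.deriv_neg ht

theorem le_one (hψ : IsGenerator ψ) {t : ℝ} (ht : 0 ≤ t) : ψ t ≤ 1 :=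
  hψ.map_zero ▸ hψ.strictAntiOn.antitoneOn self_mem_Ici ht ht

theorem mem_Ioc (hψ : IsGenerator ψ) {t : ℝ} (ht : 0 ≤ t) : ψ t ∈ Ioc (0 : ℝ) 1 :=
  ⟨hψ.pos ht, hψ.le_one ht⟩

theorem mem_Ioo (hψ : IsGenerator ψ) {t : ℝ} (ht : 0 < t) : ψ t ∈ Ioo (0 : ℝ) 1 :=
  ⟨hψ.pos_of_pos ht, hψ.map_zero ▸ hψ.strictAntiOn self_mem_Ici (mem_Ici.2 ht.le) ht⟩

theorem exists_eq (hψ : IsGenerator ψ) {x : ℝ} (hx : x ∈ Ioc (0 : ℝ) 1) : ∃ t ∈ Ici 0, ψ t = x := by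
  obtain ⟨b, hb, hb0⟩ := ((hψ.tendsto_zero.eventually (gt_mem_nhds hx.1)).and
    (eventually_ge_atTop 0)).exists
  obtain ⟨t, ht, h⟩ := intermediate_value_Icc' hb0 (hψ.continuousOn.mono Icc_subset_Ici_self)
    ⟨hb.le, hψ.map_zero.symm ▸ hx.2⟩
  exact ⟨t, ht.1, h⟩

theorem genInv_nonneg (hψ : IsGenerator ψ) {x : ℝ} (hx : x ∈ Ioc (0 : ℝ) 1) : 0 ≤ genInv ψ x :=
  Function.invFunOn_mem (hψ.exists_eq hx)

theorem apply_genInv (hψ : IsGenerator ψ) {x : ℝ} (hx : x ∈ Ioc (0 : ℝ) 1) : ψ (genInv ψ x) = x :=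
  Function.invFunOn_eq (hψ.exists_eq hx)

theorem genInv_apply (hψ : IsGenerator ψ) {t : ℝ} (ht : 0 ≤ t) : genInv ψ (ψ t) = t :=
  hψ.strictAntiOn.injOn.leftInvOn_invFunOn ht

theorem genInv_pos (hψ : IsGenerator ψ) {x : ℝ} (hx : x ∈ Ioo (0 : ℝ) 1) : 0 < genInv ψ x := by
  refine (hψ.genInv_nonneg (Ioo_subset_Ioc_self hx)).lt_of_ne fun h => hx.2.ne ?_
  rw [← hψ.apply_genInv (Ioo_subset_Ioc_self hx), ← h, hψ.map_zero]

theorem contDiffOn_genInv (hψ : IsGenerator ψ) : ContDiffOn ℝ ∞ (genInv ψ) (Ioo 0 1) := by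
  intro x hx
  refine ContDiffAt.contDiffWithinAt ?_
  set a := genInv ψ x
  have ha : 0 < a := hψ.genInv_pos hx
  have hψa : ψ a = x := hψ.apply_genInv (Ioo_subset_Ioc_self hx)
  have hc : ContDiffAt ℝ ∞ ψ a := hψ.completelyMonotone.smooth.contDiffAt (Ioi_mem_nhds ha)
  have hd := (hψ.hasDerivAt ha).hasFDerivAt_equiv (hψ.deriv_neg ha).ne
  have hsd := hc.hasStrictFDerivAt' hd (by simp)
  have hloc := hc.to_localInverse hd (by simp)
  rw [hψa] at hloc
  -- the local inverse takes positive values near `x`, where it has to agree with `genInv`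
  refine hloc.congr_of_eventuallyEq ?_
  have h1 : Tendsto (hc.localInverse hd (by simp)) (𝓝 x) (𝓝 a) := by
    have := hloc.continuousAt.tendsto
    have h2 : hc.localInverse hd (by simp) x = a := by
      conv_lhs => rw [← hψa]
      exact hc.localInverse_apply_image hd (by simp)
    rwa [h2] at this
  have h2 := hsd.eventually_right_inverse
  rw [hψa] at h2
  filter_upwards [h2, h1.eventually (Ioi_mem_nhds ha)] with y hy hy0
  conv_lhs => rw [← hy]
  exact hψ.genInv_apply (le_of_lt hy0)

theorem strictAntiOn_genInv (hψ : IsGenerator ψ) : StrictAntiOn (genInv ψ) (Ioc 0 1) :=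
  fun x hx y hy hxy => by
    by_contra h
    have := hψ.strictAntiOn.antitoneOn (hψ.genInv_nonneg hx) (hψ.genInv_nonneg hy) (not_lt.1 h)
    rw [hψ.apply_genInv hx, hψ.apply_genInv hy] at this
    exact this.not_gt hxy

theorem deriv_genInv_nonpos (hψ : IsGenerator ψ) {x : ℝ} (hx : x ∈ Ioo (0 : ℝ) 1) :
    deriv (genInv ψ) x ≤ 0 := by
  have h := (hψ.strictAntiOn_genInv.antitoneOn.mono Ioo_subset_Ioc_self).derivWithin_nonpos (x := x)
  rwa [derivWithin_of_isOpen isOpen_Ioo hx] at h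

theorem continuousOn_genInv (hψ : IsGenerator ψ) : ContinuousOn (genInv ψ) (Ioc 0 1) := by
  intro x hx
  rcases hx.2.lt_or_eq with h | rfl
  · exact (hψ.contDiffOn_genInv.contDiffAt (Ioo_mem_nhds hx.1 h)).continuousAt.continuousWithinAt
  · have h1 : genInv ψ 1 = 0 := by
      rw [← hψ.map_zero]; exact hψ.genInv_apply le_rfl
    rw [ContinuousWithinAt, h1, Metric.tendsto_nhds]
    intro ε hε
    filter_upwards [self_mem_nhdsWithin, mem_nhdsWithin_of_mem_nhds
      (lt_mem_nhds (hψ.mem_Ioo hε).2)] with y hy hyε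
    rw [Real.dist_0_eq_abs, abs_of_nonneg (hψ.genInv_nonneg hy), ← hψ.genInv_apply hε.le]
    exact hψ.strictAntiOn_genInv (hψ.mem_Ioc hε.le) hy hyε

theorem node_nonneg (hψ₀ : IsGenerator ψ₀) (hψ : IsGenerator ψ) {t : ℝ} (ht : 0 ≤ t) :
    0 ≤ node ψ₀ ψ t := hψ₀.genInv_nonneg (hψ.mem_Ioc ht)

theorem node_pos (hψ₀ : IsGenerator ψ₀) (hψ : IsGenerator ψ) {t : ℝ} (ht : 0 < t) :
    0 < node ψ₀ ψ t := hψ₀.genInv_pos (hψ.mem_Ioo ht)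

theorem contDiffOn_node (hψ₀ : IsGenerator ψ₀) (hψ : IsGenerator ψ) :
    ContDiffOn ℝ ∞ (node ψ₀ ψ) (Ioi 0) :=
  hψ₀.contDiffOn_genInv.comp hψ.completelyMonotone.smooth fun _ ht => hψ.mem_Ioo ht

theorem continuousOn_node (hψ₀ : IsGenerator ψ₀) (hψ : IsGenerator ψ) :
    ContinuousOn (node ψ₀ ψ) (Ici 0) :=
  hψ₀.continuousOn_genInv.comp hψ.continuousOn fun _ ht => hψ.mem_Ioc ht

end IsGenerator

theorem coeffNode_sign {ψ₀ ψ : ℝ → ℝ} (h : IsCompletelyMonotone (deriv (node ψ₀ ψ))) (n k : ℕ)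
    {t : ℝ} (ht : 0 < t) : 0 ≤ (-1) ^ (n + k) * coeffNode ψ₀ ψ n k t :=
  bell_sign n k fun r => by rw [iteratedDeriv_succ']; exact h.sign r t ht

/-! ### Nested Archimedean copulas -/

section copula

variable {ι : Type*} [Fintype ι] {ψ : ℝ → ℝ}

theorem archCopula_of_pos (ψ : ℝ → ℝ) {x : ι → ℝ} (hx : ∀ i, 0 < x i) :
    archCopula ψ x = ψ (∑ i, genInv ψ (x i)) := if_pos hx

theorem sum_genInv_nonneg (hψ : IsGenerator ψ) {x : ι → ℝ} (hx : ∀ i, x i ∈ Ioc (0 : ℝ) 1) :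
    0 ≤ ∑ i, genInv ψ (x i) := Finset.sum_nonneg fun i _ => hψ.genInv_nonneg (hx i)

theorem sum_genInv_pos [Nonempty ι] (hψ : IsGenerator ψ) {x : ι → ℝ} (hx : x ∈ openCube ι) :
    0 < ∑ i, genInv ψ (x i) :=
  Finset.sum_pos (fun i _ => hψ.genInv_pos (hx i)) Finset.univ_nonempty

theorem archCopula_mem_Icc (hψ : IsGenerator ψ) {x : ι → ℝ} (hx : ∀ i, x i ∈ Icc (0 : ℝ) 1) :
    archCopula ψ x ∈ Icc (0 : ℝ) 1 := by
  unfold archCopula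
  split_ifs with h
  · exact Ioc_subset_Icc_self (hψ.mem_Ioc (sum_genInv_nonneg hψ fun i => ⟨h i, (hx i).2⟩))
  · exact ⟨le_rfl, zero_le_one⟩

theorem archCopula_mem_Ioc (hψ : IsGenerator ψ) {x : ι → ℝ} (hx : ∀ i, x i ∈ Ioc (0 : ℝ) 1) :
    archCopula ψ x ∈ Ioc (0 : ℝ) 1 := by
  rw [archCopula_of_pos ψ fun i => (hx i).1]
  exact hψ.mem_Ioc (sum_genInv_nonneg hψ hx)

/-- A copula is bounded by each of its arguments. -/
theorem archCopula_le (hψ : IsGenerator ψ) {x : ι → ℝ} (hx : ∀ i, x i ∈ Icc (0 : ℝ) 1) (i : ι) :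
    archCopula ψ x ≤ x i := by
  unfold archCopula
  split_ifs with h
  · have hx' : ∀ i, x i ∈ Ioc (0 : ℝ) 1 := fun i => ⟨h i, (hx i).2⟩
    conv_rhs => rw [← hψ.apply_genInv (hx' i)]
    exact hψ.strictAntiOn.antitoneOn (hψ.genInv_nonneg (hx' i)) (sum_genInv_nonneg hψ hx')
      (Finset.single_le_sum (f := fun i => genInv ψ (x i))
        (fun i _ => hψ.genInv_nonneg (hx' i)) (Finset.mem_univ i))
  · exact (hx i).1

end copula

section nested

variable {m : ℕ} {δ : Fin m → ℕ} {ψ₀ : ℝ → ℝ} {ψ : Fin m → ℝ → ℝ}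
  {w : (Σ s : Fin m, Fin (δ s)) → ℝ}

theorem nestedCopula_mem_Icc (hψ₀ : IsGenerator ψ₀) (hψ : ∀ s, IsGenerator (ψ s))
    (hw : ∀ i, w i ∈ Icc (0 : ℝ) 1) : nestedCopula ψ₀ ψ w ∈ Icc (0 : ℝ) 1 :=
  archCopula_mem_Icc hψ₀ fun s => archCopula_mem_Icc (hψ s) fun _ => hw _

theorem nestedCopula_mem_Ioc (hψ₀ : IsGenerator ψ₀) (hψ : ∀ s, IsGenerator (ψ s))
    (hw : ∀ i, w i ∈ Ioc (0 : ℝ) 1) : nestedCopula ψ₀ ψ w ∈ Ioc (0 : ℝ) 1 :=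
  archCopula_mem_Ioc hψ₀ fun s => archCopula_mem_Ioc (hψ s) fun _ => hw _

theorem nestedCopula_le (hψ₀ : IsGenerator ψ₀) (hψ : ∀ s, IsGenerator (ψ s))
    (hw : ∀ i, w i ∈ Icc (0 : ℝ) 1) (i : Σ s : Fin m, Fin (δ s)) : nestedCopula ψ₀ ψ w ≤ w i :=
  (archCopula_le hψ₀ (fun s => archCopula_mem_Icc (hψ s) fun _ => hw _) i.1).trans
    (archCopula_le (hψ i.1) (fun _ => hw _) i.2)

theorem tStar_eq (hψ₀ : IsGenerator ψ₀) (hψ : ∀ s, IsGenerator (ψ s))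
    (hw : ∀ i, w i ∈ Ioc (0 : ℝ) 1) : tStar ψ₀ ψ w = ∑ s, node ψ₀ (ψ s) (tVec ψ w s) := by
  have h : ∀ s, archCopula (ψ s) (fun j => w ⟨s, j⟩) = ψ s (tVec ψ w s) := fun s =>
    archCopula_of_pos _ fun j => (hw _).1
  have h0 : ∀ s, 0 ≤ tVec ψ w s := fun s => sum_genInv_nonneg (hψ s) fun j => hw ⟨s, j⟩
  rw [tStar, nestedCopula, archCopula_of_pos ψ₀ fun s => by rw [h]; exact (hψ s).pos (h0 s)]
  simp only [h]
  exact hψ₀.genInv_apply (Finset.sum_nonneg fun s _ => hψ₀.node_nonneg (hψ s) (h0 s))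

theorem tStar_nonneg (hψ₀ : IsGenerator ψ₀) (hψ : ∀ s, IsGenerator (ψ s))
    (hw : ∀ i, w i ∈ Ioc (0 : ℝ) 1) : 0 ≤ tStar ψ₀ ψ w :=
  hψ₀.genInv_nonneg (nestedCopula_mem_Ioc hψ₀ hψ hw)

theorem nestedCopula_eq (hψ₀ : IsGenerator ψ₀) (hψ : ∀ s, IsGenerator (ψ s))
    (hw : ∀ i, w i ∈ Ioc (0 : ℝ) 1) : nestedCopula ψ₀ ψ w = ψ₀ (tStar ψ₀ ψ w) :=
  (hψ₀.apply_genInv (nestedCopula_mem_Ioc hψ₀ hψ hw)).symm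

theorem openCube_subset {ι : Type*} {x : ι → ℝ} (hx : x ∈ openCube ι) (i : ι) :
    x i ∈ Ioc (0 : ℝ) 1 := Ioo_subset_Ioc_self (hx i)

theorem tVec_pos (hδ : ∀ s, 1 ≤ δ s) (hψ : ∀ s, IsGenerator (ψ s)) (hw : w ∈ openCube _)
    (s : Fin m) : 0 < tVec ψ w s :=
  have : Nonempty (Fin (δ s)) := ⟨⟨0, hδ s⟩⟩
  sum_genInv_pos (hψ s) fun j => hw ⟨s, j⟩

theorem tStar_pos (hm : 1 ≤ m) (hδ : ∀ s, 1 ≤ δ s) (hψ₀ : IsGenerator ψ₀)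
    (hψ : ∀ s, IsGenerator (ψ s)) (hw : w ∈ openCube _) : 0 < tStar ψ₀ ψ w := by
  have : Nonempty (Fin m) := ⟨⟨0, hm⟩⟩
  rw [tStar_eq hψ₀ hψ (openCube_subset hw)]
  exact Finset.sum_pos (fun s _ => hψ₀.node_pos (hψ s) (tVec_pos hδ hψ hw s))
    Finset.univ_nonempty

theorem contDiffOn_tVec (hψ : ∀ s, IsGenerator (ψ s)) (s : Fin m) :
    ContDiffOn ℝ ∞ (fun w : (Σ s : Fin m, Fin (δ s)) → ℝ => tVec ψ w s) (openCube _) :=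
  ContDiffOn.sum fun j _ => (hψ s).contDiffOn_genInv.comp
    (contDiff_apply ℝ ℝ (⟨s, j⟩ : Σ s : Fin m, Fin (δ s))).contDiffOn fun _ hw => hw _

theorem contDiffOn_tStar (hδ : ∀ s, 1 ≤ δ s) (hψ₀ : IsGenerator ψ₀)
    (hψ : ∀ s, IsGenerator (ψ s)) :
    ContDiffOn ℝ ∞ (fun w : (Σ s : Fin m, Fin (δ s)) → ℝ => tStar ψ₀ ψ w) (openCube _) := by
  refine ContDiffOn.congr ?_ fun w hw => tStar_eq hψ₀ hψ (openCube_subset hw)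
  exact ContDiffOn.sum fun s _ => (hψ₀.contDiffOn_node (hψ s)).comp (contDiffOn_tVec hψ s)
    fun w hw => tVec_pos hδ hψ hw s

theorem continuousOn_tStar (hψ₀ : IsGenerator ψ₀) (hψ : ∀ s, IsGenerator (ψ s)) :
    ContinuousOn (fun w : (Σ s : Fin m, Fin (δ s)) → ℝ => tStar ψ₀ ψ w)
      {w | ∀ i, w i ∈ Ioc (0 : ℝ) 1} := by
  refine ContinuousOn.congr ?_ fun w hw => tStar_eq hψ₀ hψ hw
  refine continuousOn_finsetSum _ fun s _ => (hψ₀.continuousOn_node (hψ s)).comp ?_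
    fun w hw => sum_genInv_nonneg (hψ s) fun j => hw ⟨s, j⟩
  exact continuousOn_finsetSum _ fun j _ => (hψ s).continuousOn_genInv.comp
    (continuous_apply (⟨s, j⟩ : Σ s : Fin m, Fin (δ s))).continuousOn fun _ hw => hw _

end nested

section nested₃

variable {d₁ : ℕ} {d₂ : Fin d₁ → ℕ} {d₃ : (s₂ : Fin d₁) → Fin (d₂ s₂) → ℕ}
  {ψ₁ : ℝ → ℝ} {ψ₂ : Fin d₁ → ℝ → ℝ} {ψ₃ : (s₂ : Fin d₁) → Fin (d₂ s₂) → ℝ → ℝ}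
  {u : (Σ s₂ : Fin d₁, Σ s₃ : Fin (d₂ s₂), Fin (d₃ s₂ s₃)) → ℝ}

theorem genInv_nestedCopula₃ (hψ₁ : IsGenerator ψ₁) (hψ₂ : ∀ s₂, IsGenerator (ψ₂ s₂))
    (hψ₃ : ∀ s₂ s₃, IsGenerator (ψ₃ s₂ s₃)) (hu : ∀ i, u i ∈ Ioc (0 : ℝ) 1) :
    genInv ψ₁ (nestedCopula₃ ψ₁ ψ₂ ψ₃ u) =
      ∑ s₂, node ψ₁ (ψ₂ s₂) (tStar (ψ₂ s₂) (ψ₃ s₂) fun p => u ⟨s₂, p⟩) := by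
  have h : ∀ s₂, nestedCopula (ψ₂ s₂) (ψ₃ s₂) (fun p => u ⟨s₂, p⟩) ∈ Ioc (0 : ℝ) 1 := fun s₂ =>
    nestedCopula_mem_Ioc (hψ₂ s₂) (hψ₃ s₂) fun p => hu ⟨s₂, p⟩
  rw [nestedCopula₃, archCopula_of_pos ψ₁ fun s₂ => (h s₂).1,
    hψ₁.genInv_apply (sum_genInv_nonneg hψ₁ h)]
  exact Finset.sum_congr rfl fun s₂ _ => by
    rw [node, ← nestedCopula_eq (hψ₂ s₂) (hψ₃ s₂) fun p => hu ⟨s₂, p⟩]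

theorem nestedCopula₃_mem_Ioc (hψ₁ : IsGenerator ψ₁) (hψ₂ : ∀ s₂, IsGenerator (ψ₂ s₂))
    (hψ₃ : ∀ s₂ s₃, IsGenerator (ψ₃ s₂ s₃)) (hu : ∀ i, u i ∈ Ioc (0 : ℝ) 1) :
    nestedCopula₃ ψ₁ ψ₂ ψ₃ u ∈ Ioc (0 : ℝ) 1 :=
  archCopula_mem_Ioc hψ₁ fun s₂ => nestedCopula_mem_Ioc (hψ₂ s₂) (hψ₃ s₂) fun p => hu ⟨s₂, p⟩

theorem nestedCopula₃_eq (hψ₁ : IsGenerator ψ₁) (hψ₂ : ∀ s₂, IsGenerator (ψ₂ s₂))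
    (hψ₃ : ∀ s₂ s₃, IsGenerator (ψ₃ s₂ s₃)) (hu : ∀ i, u i ∈ Ioc (0 : ℝ) 1) :
    nestedCopula₃ ψ₁ ψ₂ ψ₃ u =
      ψ₁ (∑ s₂, node ψ₁ (ψ₂ s₂) (tStar (ψ₂ s₂) (ψ₃ s₂) fun p => u ⟨s₂, p⟩)) := by
  rw [← genInv_nestedCopula₃ hψ₁ hψ₂ hψ₃ hu,
    hψ₁.apply_genInv (nestedCopula₃_mem_Ioc hψ₁ hψ₂ hψ₃ hu)]

theorem nestedCopula₃_nonneg (hψ₁ : IsGenerator ψ₁) (hψ₂ : ∀ s₂, IsGenerator (ψ₂ s₂))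
    (hψ₃ : ∀ s₂ s₃, IsGenerator (ψ₃ s₂ s₃)) (hu : ∀ i, u i ∈ Icc (0 : ℝ) 1) :
    0 ≤ nestedCopula₃ ψ₁ ψ₂ ψ₃ u :=
  (archCopula_mem_Icc hψ₁ fun s₂ =>
    nestedCopula_mem_Icc (hψ₂ s₂) (hψ₃ s₂) fun p => hu ⟨s₂, p⟩).1

theorem nestedCopula₃_le (hψ₁ : IsGenerator ψ₁) (hψ₂ : ∀ s₂, IsGenerator (ψ₂ s₂))
    (hψ₃ : ∀ s₂ s₃, IsGenerator (ψ₃ s₂ s₃)) (hu : ∀ i, u i ∈ Icc (0 : ℝ) 1)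
    (i : Σ s₂ : Fin d₁, Σ s₃ : Fin (d₂ s₂), Fin (d₃ s₂ s₃)) :
    nestedCopula₃ ψ₁ ψ₂ ψ₃ u ≤ u i :=
  (archCopula_le hψ₁ (fun s₂ => nestedCopula_mem_Icc (hψ₂ s₂) (hψ₃ s₂) fun p => hu ⟨s₂, p⟩)
    i.1).trans (nestedCopula_le (hψ₂ i.1) (hψ₃ i.1) (fun p => hu ⟨i.1, p⟩) i.2)

theorem continuousOn_nestedCopula₃ (hψ₁ : IsGenerator ψ₁) (hψ₂ : ∀ s₂, IsGenerator (ψ₂ s₂))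
    (hψ₃ : ∀ s₂ s₃, IsGenerator (ψ₃ s₂ s₃)) :
    ContinuousOn (nestedCopula₃ (d₃ := d₃) ψ₁ ψ₂ ψ₃) {u | ∀ i, u i ∈ Ioc (0 : ℝ) 1} := by
  refine ContinuousOn.congr ?_ fun u hu => nestedCopula₃_eq hψ₁ hψ₂ hψ₃ hu
  have h0 : ∀ s₂, ∀ u : (Σ s₂ : Fin d₁, Σ s₃ : Fin (d₂ s₂), Fin (d₃ s₂ s₃)) → ℝ,
      (∀ i, u i ∈ Ioc (0 : ℝ) 1) → 0 ≤ tStar (ψ₂ s₂) (ψ₃ s₂) fun p => u ⟨s₂, p⟩ :=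
    fun s₂ u hu => tStar_nonneg (hψ₂ s₂) (hψ₃ s₂) fun p => hu ⟨s₂, p⟩
  have hc : ∀ s₂, ContinuousOn
      (fun u : (Σ s₂ : Fin d₁, Σ s₃ : Fin (d₂ s₂), Fin (d₃ s₂ s₃)) → ℝ =>
        tStar (ψ₂ s₂) (ψ₃ s₂) fun p => u ⟨s₂, p⟩) {u | ∀ i, u i ∈ Ioc (0 : ℝ) 1} := fun s₂ => by
    have hr : Continuous
        (fun (u : (Σ s₂ : Fin d₁, Σ s₃ : Fin (d₂ s₂), Fin (d₃ s₂ s₃)) → ℝ) p => u ⟨s₂, p⟩) :=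
      continuous_pi fun p => continuous_apply _
    exact (continuousOn_tStar (hψ₂ s₂) (hψ₃ s₂)).comp hr.continuousOn fun u hu p => hu ⟨s₂, p⟩
  have hn : ∀ s₂, ContinuousOn
      (fun u : (Σ s₂ : Fin d₁, Σ s₃ : Fin (d₂ s₂), Fin (d₃ s₂ s₃)) → ℝ =>
        node ψ₁ (ψ₂ s₂) (tStar (ψ₂ s₂) (ψ₃ s₂) fun p => u ⟨s₂, p⟩))
      {u | ∀ i, u i ∈ Ioc (0 : ℝ) 1} := fun s₂ =>
    (hψ₁.continuousOn_node (hψ₂ s₂)).comp (hc s₂) fun u hu => h0 s₂ u hu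
  exact hψ₁.continuousOn.comp (continuousOn_finsetSum _ fun s₂ _ => hn s₂) fun u hu =>
    Finset.sum_nonneg fun s₂ _ => hψ₁.node_nonneg (hψ₂ s₂) (h0 s₂ u hu)

theorem contDiffOn_nestedCopula₃ (hd₁ : 1 ≤ d₁) (hd₂ : ∀ s₂, 1 ≤ d₂ s₂)
    (hd₃ : ∀ s₂ s₃, 1 ≤ d₃ s₂ s₃) (hψ₁ : IsGenerator ψ₁) (hψ₂ : ∀ s₂, IsGenerator (ψ₂ s₂))
    (hψ₃ : ∀ s₂ s₃, IsGenerator (ψ₃ s₂ s₃)) :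
    ContDiffOn ℝ ∞ (nestedCopula₃ (d₃ := d₃) ψ₁ ψ₂ ψ₃) (openCube _) := by
  refine ContDiffOn.congr ?_ fun u hu => nestedCopula₃_eq hψ₁ hψ₂ hψ₃ (openCube_subset hu)
  have : Nonempty (Fin d₁) := ⟨⟨0, hd₁⟩⟩
  have h0 : ∀ s₂, ∀ u ∈ openCube (Σ s₂ : Fin d₁, Σ s₃ : Fin (d₂ s₂), Fin (d₃ s₂ s₃)),
      0 < tStar (ψ₂ s₂) (ψ₃ s₂) fun p => u ⟨s₂, p⟩ :=
    fun s₂ u hu => tStar_pos (hd₂ s₂) (hd₃ s₂) (hψ₂ s₂) (hψ₃ s₂) fun p => hu ⟨s₂, p⟩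
  have hc : ∀ s₂, ContDiffOn ℝ ∞
      (fun u : (Σ s₂ : Fin d₁, Σ s₃ : Fin (d₂ s₂), Fin (d₃ s₂ s₃)) → ℝ =>
        tStar (ψ₂ s₂) (ψ₃ s₂) fun p => u ⟨s₂, p⟩) (openCube _) := fun s₂ => by
    have hr : ContDiff ℝ ∞
        (fun (u : (Σ s₂ : Fin d₁, Σ s₃ : Fin (d₂ s₂), Fin (d₃ s₂ s₃)) → ℝ) p => u ⟨s₂, p⟩) :=
      contDiff_pi.2 fun p => contDiff_apply ℝ ℝ _
    exact (contDiffOn_tStar (hd₃ s₂) (hψ₂ s₂) (hψ₃ s₂)).comp hr.contDiffOn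
      fun u hu p => hu ⟨s₂, p⟩
  have hn : ∀ s₂, ContDiffOn ℝ ∞
      (fun u : (Σ s₂ : Fin d₁, Σ s₃ : Fin (d₂ s₂), Fin (d₃ s₂ s₃)) → ℝ =>
        node ψ₁ (ψ₂ s₂) (tStar (ψ₂ s₂) (ψ₃ s₂) fun p => u ⟨s₂, p⟩)) (openCube _) := fun s₂ =>
    (hψ₁.contDiffOn_node (hψ₂ s₂)).comp (hc s₂) fun u hu => h0 s₂ u hu
  exact hψ₁.completelyMonotone.smooth.comp (ContDiffOn.sum fun s₂ _ => hn s₂) fun u hu =>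
    Finset.sum_pos (fun s₂ _ => hψ₁.node_pos (hψ₂ s₂) (h0 s₂ u hu)) Finset.univ_nonempty

end nested₃

/-! ### Iterated differences over boxes -/

section boxDiff

variable {ι : Type*} [DecidableEq ι]

/-- Fixing the `i`-th variable commutes with differentiation in the other variables. -/
theorem iteratedPartial_comp_update (F : (ι → ℝ) → ℝ) {i : ι} {L : List ι} (hi : i ∉ L) (y : ℝ)
    (x : ι → ℝ) : iteratedPartial L (fun x => F (Function.update x i y)) x =
      iteratedPartial L F (Function.update x i y) := by
  induction L generalizing x with
  | nil => rfl
  | cons j L ih =>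
    rw [List.mem_cons, not_or] at hi
    change deriv (fun z => iteratedPartial L (fun x => F (Function.update x i y))
      (Function.update x j z)) (x j) = deriv (fun z => iteratedPartial L F
      (Function.update (Function.update x i y) j z)) (Function.update x i y j)
    simp only [ih hi.2, Function.update_of_ne (Ne.symm hi.1), Function.update_comm (Ne.symm hi.1)]

/-- The iterated difference of `F` over the box with corners `a` and `b`, in the variables of the
list. -/
noncomputable def boxDiff (a b : ι → ℝ) : List ι → ((ι → ℝ) → ℝ) → (ι → ℝ) → ℝ
  | [], F => F
  | i :: L, F => boxDiff a b L fun x =>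
      F (Function.update x i (b i)) - F (Function.update x i (a i))

/-- The iterated difference is close to the value at the upper corner if `F` is small on the lower
faces of the box. Each variable doubles the bound for the difference and adds one term on a lower
face, which accounts for the powers of `3`. -/
theorem abs_boxDiff_sub_le {a b : ι → ℝ} (ha : a ∈ openCube ι) (hb : b ∈ openCube ι) {ε : ℝ}
    (hε : 0 ≤ ε) {L : List ι} (hL : L.Nodup) {F : (ι → ℝ) → ℝ}
    (hF : ∀ x ∈ openCube ι, ∀ i ∈ L, x i = a i → |F x| ≤ ε) {x : ι → ℝ} (hx : x ∈ openCube ι) :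
    |boxDiff a b L F x - F (fun j => if j ∈ L then b j else x j)| ≤ 3 ^ L.length * ε := by
  induction L generalizing F ε with
  | nil => simpa [boxDiff] using hε
  | cons i L ih =>
    obtain ⟨hi, hL'⟩ := List.nodup_cons.1 hL
    set x' : ι → ℝ := fun j => if j ∈ L then b j else x j with hx'def
    have hx' : x' ∈ openCube ι := fun j => by
      simp only [hx'def]; split_ifs; exacts [hb j, hx j]
    have hupd : (fun j => if j ∈ i :: L then b j else x j) = Function.update x' i (b i) := by
      funext j
      rcases eq_or_ne j i with rfl | h
      · simp
      · simp [hx'def, h]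
    have h1 := ih (mul_nonneg zero_le_two hε) hL' (F := fun x =>
      F (Function.update x i (b i)) - F (Function.update x i (a i))) fun z hz j hj hzj => by
        have hji : j ≠ i := ne_of_mem_of_not_mem hj hi
        have h := fun y (hy : y ∈ Ioo (0 : ℝ) 1) =>
          hF (Function.update z i y) (update_mem_openCube hz i hy) j (List.mem_cons_of_mem i hj)
            (by rw [Function.update_of_ne hji, hzj])
        refine (abs_sub _ _).trans ?_
        linarith [h (b i) (hb i), h (a i) (ha i)]
    have h2 : |F (Function.update x' i (a i))| ≤ ε :=
      hF _ (update_mem_openCube hx' i (ha i)) i List.mem_cons_self (by simp)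
    rw [hupd, boxDiff, List.length_cons, pow_succ]
    have h3 : (1 : ℝ) ≤ 3 ^ L.length := one_le_pow₀ (by norm_num)
    have h4 := abs_sub_le (boxDiff a b L (fun x =>
      F (Function.update x i (b i)) - F (Function.update x i (a i))) x)
      (F (Function.update x' i (b i)) - F (Function.update x' i (a i)))
      (F (Function.update x' i (b i)))
    rw [sub_sub_cancel_left, abs_neg] at h4
    nlinarith

end boxDiff

/-! ### Smoothness of partial derivatives on the cube -/

section partialDeriv

variable {ι : Type*} [Fintype ι]

theorem isOpen_openCube (ι : Type*) [Fintype ι] : IsOpen (openCube ι) := by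
  have : openCube ι = Set.univ.pi fun _ => Ioo (0 : ℝ) 1 := by ext; simp [openCube]
  rw [this]
  exact isOpen_set_pi Set.finite_univ fun _ _ => isOpen_Ioo

variable [DecidableEq ι]

theorem hasDerivAt_comp_update {F : (ι → ℝ) → ℝ} (hF : ContDiffOn ℝ ∞ F (openCube ι)) (i : ι)
    {x : ι → ℝ} (hx : x ∈ openCube ι) :
    HasDerivAt (fun y => F (Function.update x i y)) (fderiv ℝ F x (Pi.single i 1)) (x i) := by
  have h := ((hF.contDiffAt ((isOpen_openCube ι).mem_nhds hx)).differentiableAt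
    (by simp)).hasFDerivAt
  exact h.comp_hasDerivAt_of_eq (x i) (hasDerivAt_update x i (x i)) (Function.update_eq_self i x).symm

theorem partialDeriv_eq_fderiv {F : (ι → ℝ) → ℝ} (hF : ContDiffOn ℝ ∞ F (openCube ι)) (i : ι)
    {x : ι → ℝ} (hx : x ∈ openCube ι) : partialDeriv i F x = fderiv ℝ F x (Pi.single i 1) :=
  (hasDerivAt_comp_update hF i hx).deriv

theorem contDiffOn_partialDeriv {F : (ι → ℝ) → ℝ} (hF : ContDiffOn ℝ ∞ F (openCube ι)) (i : ι) :
    ContDiffOn ℝ ∞ (partialDeriv i F) (openCube ι) :=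
  ((hF.fderiv_of_isOpen (isOpen_openCube ι) (by simp)).clm_apply contDiffOn_const).congr
    fun _ hx => partialDeriv_eq_fderiv hF i hx

theorem contDiffOn_iteratedPartial {F : (ι → ℝ) → ℝ} (hF : ContDiffOn ℝ ∞ F (openCube ι))
    (L : List ι) : ContDiffOn ℝ ∞ (iteratedPartial L F) (openCube ι) := by
  induction L with
  | nil => exact hF
  | cons i L ih => exact contDiffOn_partialDeriv ih i

theorem contDiffOn_comp_update {F : (ι → ℝ) → ℝ} (hF : ContDiffOn ℝ ∞ F (openCube ι)) (i : ι)
    {y : ℝ} (hy : y ∈ Ioo (0 : ℝ) 1) :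
    ContDiffOn ℝ ∞ (fun x => F (Function.update x i y)) (openCube ι) := by
  refine hF.comp (ContDiff.contDiffOn (contDiff_pi.2 fun j => ?_))
    fun x hx => update_mem_openCube hx i hy
  rcases eq_or_ne j i with rfl | h
  · simpa using contDiff_const
  · simpa [h] using contDiff_apply ℝ ℝ j

theorem iteratedPartial_sub {F G : (ι → ℝ) → ℝ} (hF : ContDiffOn ℝ ∞ F (openCube ι))
    (hG : ContDiffOn ℝ ∞ G (openCube ι)) (L : List ι) {x : ι → ℝ} (hx : x ∈ openCube ι) :
    iteratedPartial L (fun x => F x - G x) x = iteratedPartial L F x - iteratedPartial L G x := by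
  induction L generalizing x with
  | nil => rfl
  | cons i L ih =>
    have hev : (fun y => iteratedPartial L (fun x => F x - G x) (Function.update x i y)) =ᶠ[𝓝 (x i)]
        fun y => iteratedPartial L F (Function.update x i y) -
          iteratedPartial L G (Function.update x i y) :=
      (eventually_update_mem_openCube hx i).mono fun y hy => ih hy
    change deriv (fun y => iteratedPartial L (fun x => F x - G x) (Function.update x i y)) (x i) =
      deriv (fun y => iteratedPartial L F (Function.update x i y)) (x i) -
      deriv (fun y => iteratedPartial L G (Function.update x i y)) (x i)
    rw [hev.deriv_eq]
    exact deriv_fun_sub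
      (hasDerivAt_comp_update (contDiffOn_iteratedPartial hF L) i hx).differentiableAt
      (hasDerivAt_comp_update (contDiffOn_iteratedPartial hG L) i hx).differentiableAt

/-! ### Integrals of mixed partial derivatives over boxes -/

/-- A marginal integral over a box in the open cube depends only on the values in the cube. -/
theorem lmarginal_congr_openCube {a b : ι → ℝ} (ha : a ∈ openCube ι) (hb : b ∈ openCube ι)
    {f g : (ι → ℝ) → ENNReal} (hfg : ∀ x ∈ openCube ι, f x = g x) (s : Finset ι) {x : ι → ℝ}
    (hx : x ∈ openCube ι) :
    lmarginal (fun i => volume.restrict (Ioo (a i) (b i))) s f x =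
      lmarginal (fun i => volume.restrict (Ioo (a i) (b i))) s g x := by
  unfold lmarginal
  rw [← Measure.restrict_pi_pi]
  refine setLIntegral_congr_fun (MeasurableSet.univ_pi fun _ => measurableSet_Ioo) fun y hy =>
    hfg _ fun j => ?_
  rw [Function.updateFinset_def]
  dsimp only
  split_ifs with h
  · have := hy ⟨j, h⟩ trivial
    exact ⟨(ha j).1.trans this.1, this.2.trans (hb j).2⟩
  · exact hx j

/-- The fundamental theorem of calculus for a nonnegative mixed partial derivative over a box. The
function is cut off outside the open cube, where nothing is known about it. -/
theorem lmarginal_iteratedPartial {a b : ι → ℝ} (ha : a ∈ openCube ι) (hb : b ∈ openCube ι)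
    (hab : a ≤ b) {L : List ι} (hL : L.Nodup) {F : (ι → ℝ) → ℝ}
    (hF : ContDiffOn ℝ ∞ F (openCube ι)) (h0 : ∀ x ∈ openCube ι, 0 ≤ iteratedPartial L F x)
    {x : ι → ℝ} (hx : x ∈ openCube ι) :
    lmarginal (fun i => volume.restrict (Ioo (a i) (b i))) L.toFinset
        ((openCube ι).indicator fun x => ENNReal.ofReal (iteratedPartial L F x)) x =
      ENNReal.ofReal (boxDiff a b L F x) := by
  induction L generalizing F x with
  | nil => simp [boxDiff, iteratedPartial, hx]
  | cons i L ih =>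
    obtain ⟨hi, hL'⟩ := List.nodup_cons.1 hL
    have hupd : ∀ z : ι → ℝ, Continuous fun y : ℝ => Function.update z i y := fun z =>
      continuous_const.update i continuous_id
    have hFL := contDiffOn_iteratedPartial hF L
    have hFc := contDiffOn_iteratedPartial hF (i :: L)
    have hmeas : Measurable
        ((openCube ι).indicator fun x => ENNReal.ofReal (iteratedPartial (i :: L) F x)) := by
      classical
      rw [← Set.piecewise_eq_indicator]
      exact (ENNReal.continuous_ofReal.comp_continuousOn hFc.continuousOn).measurable_piecewise
        continuousOn_const (isOpen_openCube ι).measurableSet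
    have hG : ContDiffOn ℝ ∞
        (fun x => F (Function.update x i (b i)) - F (Function.update x i (a i))) (openCube ι) :=
      (contDiffOn_comp_update hF i (hb i)).sub (contDiffOn_comp_update hF i (ha i))
    have hDG : ∀ z ∈ openCube ι, iteratedPartial L
        (fun x => F (Function.update x i (b i)) - F (Function.update x i (a i))) z =
        ∫ y in (a i)..(b i), iteratedPartial (i :: L) F (Function.update z i y) := by
      intro z hz
      have hIcc : ∀ y ∈ uIcc (a i) (b i), y ∈ Ioo (0 : ℝ) 1 := fun y hy => by
        rw [uIcc_of_le (hab i)] at hy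
        exact ⟨(ha i).1.trans_le hy.1, hy.2.trans_lt (hb i).2⟩
      rw [iteratedPartial_sub (contDiffOn_comp_update hF i (hb i))
        (contDiffOn_comp_update hF i (ha i)) L hz, iteratedPartial_comp_update F hi,
        iteratedPartial_comp_update F hi]
      refine (intervalIntegral.integral_eq_sub_of_hasDerivAt
        (f := fun y => iteratedPartial L F (Function.update z i y)) (fun y hy => ?_) ?_).symm
      · have hmem := update_mem_openCube hz i (hIcc y hy)
        have := hasDerivAt_comp_update hFL i hmem
        rw [← partialDeriv_eq_fderiv hFL i hmem] at this
        simp only [Function.update_idem, Function.update_self] at this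
        exact this
      · refine ContinuousOn.intervalIntegrable (hFc.continuousOn.comp
          (f := fun y => Function.update z i y) ?_ fun y hy => update_mem_openCube hz i (hIcc y hy))
        exact (hupd z).continuousOn
    have hDG0 : ∀ z ∈ openCube ι, 0 ≤ iteratedPartial L
        (fun x => F (Function.update x i (b i)) - F (Function.update x i (a i))) z := by
      intro z hz
      rw [hDG z hz]
      exact intervalIntegral.integral_nonneg (hab i) fun y hy =>
        h0 _ (update_mem_openCube hz i ⟨(ha i).1.trans_le hy.1, hy.2.trans_lt (hb i).2⟩)
    rw [List.toFinset_cons, lmarginal_insert' _ hmeas (by simpa using hi)]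
    refine Eq.trans (lmarginal_congr_openCube ha hb (fun z hz => ?_) _ hx) (ih hL' hG hDG0 hx)
    rw [indicator_of_mem hz, hDG z hz, intervalIntegral.integral_of_le (hab i),
      integral_Ioc_eq_integral_Ioo]
    have hIoo : ∀ y ∈ Ioo (a i) (b i), y ∈ Ioo (0 : ℝ) 1 := fun y hy =>
      ⟨(ha i).1.trans hy.1, hy.2.trans (hb i).2⟩
    have hIcc : ∀ y ∈ Icc (a i) (b i), y ∈ Ioo (0 : ℝ) 1 := fun y hy =>
      ⟨(ha i).1.trans_le hy.1, hy.2.trans_lt (hb i).2⟩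
    rw [ofReal_integral_eq_lintegral_ofReal]
    · refine setLIntegral_congr_fun measurableSet_Ioo fun y hy => ?_
      exact indicator_of_mem (update_mem_openCube hz i (hIoo y hy)) _
    · refine (ContinuousOn.integrableOn_compact isCompact_Icc ?_).mono_set Ioo_subset_Icc_self
      exact hFc.continuousOn.comp (f := fun y => Function.update z i y)
        (hupd z).continuousOn
        fun y hy => update_mem_openCube hz i (hIcc y hy)
    · exact (ae_restrict_mem measurableSet_Ioo).mono fun y hy =>
        h0 _ (update_mem_openCube hz i (hIoo y hy))

/-- Over a box in the open cube, a nonnegative mixed partial derivative integrates to the iterated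
difference. -/
theorem setLIntegral_box_eq {a b : ι → ℝ} (ha : a ∈ openCube ι) (hb : b ∈ openCube ι)
    (hab : a ≤ b) {L : List ι} (hL : IsEnumeration L) {F : (ι → ℝ) → ℝ}
    (hF : ContDiffOn ℝ ∞ F (openCube ι)) (h0 : ∀ x ∈ openCube ι, 0 ≤ iteratedPartial L F x) :
    ∫⁻ x in Set.univ.pi fun i => Ioo (a i) (b i), ENNReal.ofReal (iteratedPartial L F x) =
      ENNReal.ofReal (boxDiff a b L F b) := by
  have huniv : L.toFinset = Finset.univ := by ext i; simp [hL.2 i]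
  rw [← lmarginal_iteratedPartial ha hb hab hL.1 hF h0 hb, huniv, lmarginal_univ,
    ← Measure.restrict_pi_pi]
  refine setLIntegral_congr_fun (MeasurableSet.univ_pi fun _ => measurableSet_Ioo) fun y hy => ?_
  have hy' : y ∈ openCube ι := fun j =>
    ⟨(ha j).1.trans (hy j trivial).1, (hy j trivial).2.trans (hb j).2⟩
  exact (indicator_of_mem hy' fun x => ENNReal.ofReal (iteratedPartial L F x)).symm

/-- A distribution function that is smooth inside the cube, continuous up to the upper faces, and
bounded by each argument, has its mixed partial derivative as density if that is nonnegative. No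
mass is lost at the lower faces because the function is small near them. -/
theorem isDensityOf_of_iteratedPartial {C c : (ι → ℝ) → ℝ} (hC : ContDiffOn ℝ ∞ C (openCube ι))
    (hcont : ContinuousOn C {u | ∀ i, u i ∈ Ioc (0 : ℝ) 1})
    (hC0 : ∀ u : ι → ℝ, (∀ i, u i ∈ Icc (0 : ℝ) 1) → 0 ≤ C u)
    (hCle : ∀ u : ι → ℝ, (∀ i, u i ∈ Icc (0 : ℝ) 1) → ∀ i, C u ≤ u i)
    {L : List ι} (hL : IsEnumeration L) (hc : ∀ u ∈ openCube ι, iteratedPartial L C u = c u)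
    (hc0 : ∀ u ∈ openCube ι, 0 ≤ c u) : IsDensityOf c C := by
  have hD0 : ∀ u ∈ openCube ι, 0 ≤ iteratedPartial L C u := fun u hu => hc u hu ▸ hc0 u hu
  have hccont : ContinuousOn c (openCube ι) :=
    (contDiffOn_iteratedPartial hC L).continuousOn.congr fun u hu => (hc u hu).symm
  have hbox : ∀ u : ι → ℝ, (∀ i, u i ∈ Ioc (0 : ℝ) 1) →
      ∫⁻ x in Set.univ.pi fun i => Ioo 0 (u i), ENNReal.ofReal (c x) = ENNReal.ofReal (C u) := by
    intro u hu
    -- exhaust the box by boxes whose closures lie in the open cube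
    set r : ℕ → ℝ := fun n => 1 / ((n : ℝ) + 3) with hr
    have hr0 : ∀ n, 0 < r n := fun n => by positivity
    have hr1 : ∀ n, r n < 1 / 2 := fun n => by
      have : (0 : ℝ) ≤ n := n.cast_nonneg
      exact one_div_lt_one_div_of_lt two_pos (by linarith)
    have hranti : Antitone r := fun m n hmn => by
      simp only [hr]; gcongr
    have hrlim : Tendsto r atTop (𝓝 0) :=
      tendsto_const_nhds.div_atTop (tendsto_natCast_atTop_atTop.atTop_add tendsto_const_nhds)
    set a : ℕ → ι → ℝ := fun n i => u i * r n with ha'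
    set b : ℕ → ι → ℝ := fun n i => u i * (1 - r n) with hb'
    have ha : ∀ n, a n ∈ openCube ι := fun n i => by
      have := hu i; have := hr0 n; have := hr1 n
      constructor
      · exact mul_pos (hu i).1 (hr0 n)
      · simp only [ha']; nlinarith [this, (hu i).1, (hu i).2]
    have hb : ∀ n, b n ∈ openCube ι := fun n i => by
      have := hr0 n; have := hr1 n
      constructor
      · exact mul_pos (hu i).1 (by linarith)
      · simp only [hb']; nlinarith [hr0 n, hr1 n, (hu i).1, (hu i).2]
    have hab : ∀ n, a n ≤ b n := fun n i =>
      mul_le_mul_of_nonneg_left (by linarith [hr1 n]) (hu i).1.le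
    have hblim : Tendsto b atTop (𝓝 u) := tendsto_pi_nhds.2 fun i => by
      simpa using (hrlim.const_sub 1).const_mul (u i)
    have hunion : ⋃ n, (Set.univ.pi fun i => Ioo (a n i) (b n i)) =
        Set.univ.pi fun i => Ioo 0 (u i) := by
      refine Subset.antisymm (iUnion_subset fun n x hx i _ => ?_) fun x hx => ?_
      · refine ⟨(ha n i).1.trans (hx i trivial).1, (hx i trivial).2.trans_le ?_⟩
        simp only [hb']; nlinarith [hr0 n, (hu i).1]
      · have halim : Tendsto a atTop (𝓝 fun _ => 0) := tendsto_pi_nhds.2 fun i => by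
          simpa using hrlim.const_mul (u i)
        have : ∀ᶠ n in atTop, ∀ i, a n i < x i ∧ x i < b n i := eventually_all.2 fun i =>
          ((tendsto_pi_nhds.1 halim i).eventually (gt_mem_nhds (hx i trivial).1)).and
            ((tendsto_pi_nhds.1 hblim i).eventually (lt_mem_nhds (hx i trivial).2))
        obtain ⟨n, hn⟩ := this.exists
        exact mem_iUnion.2 ⟨n, fun i _ => hn i⟩
    have hmono : Monotone fun n => Set.univ.pi fun i => Ioo (a n i) (b n i) := fun m n hmn =>
      Set.pi_mono fun i _ => Ioo_subset_Ioo
        (mul_le_mul_of_nonneg_left (hranti hmn) (hu i).1.le)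
        (mul_le_mul_of_nonneg_left (sub_le_sub_left (hranti hmn) 1) (hu i).1.le)
    have hmeas : ∀ a b : ι → ℝ, MeasurableSet (Set.univ.pi fun i => Ioo (a i) (b i)) := fun a b =>
      MeasurableSet.univ_pi fun _ => measurableSet_Ioo
    have hlim₁ := tendsto_measure_iUnion_atTop
      (μ := volume.withDensity fun x => ENNReal.ofReal (c x)) hmono
    rw [hunion, withDensity_apply _ (hmeas _ _)] at hlim₁
    refine tendsto_nhds_unique hlim₁ ?_
    have hval : ∀ n, volume.withDensity (fun x => ENNReal.ofReal (c x))
        (Set.univ.pi fun i => Ioo (a n i) (b n i)) =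
        ENNReal.ofReal (boxDiff (a n) (b n) L C (b n)) := fun n => by
      rw [withDensity_apply _ (hmeas _ _), ← setLIntegral_box_eq (ha n) (hb n) (hab n) hL hC hD0]
      refine setLIntegral_congr_fun (hmeas _ _) fun x hx => ?_
      rw [hc x fun j => ⟨(ha n j).1.trans (hx j trivial).1, (hx j trivial).2.trans (hb n j).2⟩]
    change Tendsto (fun n => volume.withDensity (fun x => ENNReal.ofReal (c x))
      (Set.univ.pi fun i => Ioo (a n i) (b n i))) atTop _
    simp only [hval]
    refine (ENNReal.continuous_ofReal.tendsto _).comp ?_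
    have hCb : Tendsto (fun n => C (b n)) atTop (𝓝 (C u)) :=
      (hcont u hu).tendsto.comp (tendsto_nhdsWithin_iff.2
        ⟨hblim, Eventually.of_forall fun n i => Ioo_subset_Ioc_self (hb n i)⟩)
    have hdiff : Tendsto (fun n => boxDiff (a n) (b n) L C (b n) - C (b n)) atTop (𝓝 0) := by
      refine squeeze_zero_norm (fun n => ?_) (by simpa using hrlim.const_mul (3 ^ L.length : ℝ))
      have := abs_boxDiff_sub_le (ha n) (hb n) (hr0 n).le hL.1 (F := C) (x := b n)
        (fun x hx i _ hxi => ?_) (hb n)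
      · simpa using this
      · have hx' : ∀ i, x i ∈ Icc (0 : ℝ) 1 := fun i => Ioo_subset_Icc_self (hx i)
        rw [abs_of_nonneg (hC0 x hx')]
        refine (hCle x hx' i).trans (hxi.trans_le ?_)
        simp only [ha']; nlinarith [hr0 n, (hu i).2]
    simpa using hdiff.add hCb
  have hsub : ∀ u : ι → ℝ, (∀ i, u i ∈ Icc (0 : ℝ) 1) →
      (Set.univ.pi fun i => Ioo 0 (u i)) ⊆ openCube ι := fun u hu x hx i =>
    ⟨(hx i trivial).1, (hx i trivial).2.trans_le (hu i).2⟩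
  have hmeas : ∀ u : ι → ℝ, MeasurableSet (Set.univ.pi fun i => Ioo 0 (u i)) := fun u =>
    MeasurableSet.univ_pi fun _ => measurableSet_Ioo
  refine ⟨hc0, ⟨hccont.aestronglyMeasurable (isOpen_openCube ι).measurableSet, ?_⟩, ?_⟩
  · have hcube : openCube ι = Set.univ.pi fun _ => Ioo (0 : ℝ) 1 := by ext; simp [openCube]
    rw [hasFiniteIntegral_iff_ofReal ((ae_restrict_mem (isOpen_openCube ι).measurableSet).mono
      fun x hx => hc0 x hx), hcube, hbox (fun _ => 1) fun _ => by simp]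
    exact ENNReal.ofReal_lt_top
  · intro u hu
    by_cases h : ∀ i, 0 < u i
    · rw [integral_eq_lintegral_of_nonneg_ae ((ae_restrict_mem (hmeas u)).mono
        fun x hx => hc0 x (hsub u hu hx)) ((hccont.mono (hsub u hu)).aestronglyMeasurable (hmeas u)),
        hbox u fun i => ⟨h i, (hu i).2⟩, ENNReal.toReal_ofReal (hC0 u hu)]
    · push Not at h
      obtain ⟨i, hi⟩ := h
      have hui : u i = 0 := le_antisymm hi (hu i).1
      have hempty : (Set.univ.pi fun i => Ioo 0 (u i)) = ∅ :=
        Set.univ_pi_eq_empty (i := i) (by simp [hui])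
      rw [hempty, setIntegral_empty]
      exact le_antisymm (hC0 u hu) (hui ▸ hCle u hu i)

end partialDeriv

/-! ### Cauchy products -/

theorem Icc_subset_range_succ (a n : ℕ) : Finset.Icc a n ⊆ Finset.range (n + 1) := fun _ h =>
  Finset.mem_range.2 (Nat.lt_succ_of_le (Finset.mem_Icc.1 h).2)

section cauchyIndex

variable {m : ℕ} {δ : Fin m → ℕ}

theorem mem_cauchyIndex {k : ℕ} {j : Fin m → ℕ} :
    j ∈ cauchyIndex δ k ↔ (∀ s, 1 ≤ j s ∧ j s ≤ δ s) ∧ ∑ s, j s = k := by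
  simp [cauchyIndex, Fintype.mem_piFinset]

theorem mem_Icc_of_mem_cauchyIndex {k : ℕ} {j : Fin m → ℕ} (hj : j ∈ cauchyIndex δ k) :
    k ∈ Finset.Icc m (∑ s, δ s) := by
  obtain ⟨h, rfl⟩ := mem_cauchyIndex.1 hj
  refine Finset.mem_Icc.2 ⟨?_, Finset.sum_le_sum fun s _ => (h s).2⟩
  simpa using Finset.card_nsmul_le_sum Finset.univ j 1 fun s _ => (h s).1

theorem sum_cauchyIndex_eq_zero {R : Type*} [AddCommMonoid R] {k : ℕ}
    (hk : k ∉ Finset.Icc m (∑ s, δ s)) (f : (Fin m → ℕ) → R) :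
    ∑ j ∈ cauchyIndex δ k, f j = 0 :=
  Finset.sum_eq_zero fun _ hj => absurd (mem_Icc_of_mem_cauchyIndex hj) hk

/-- Product of polynomials without constant term; its terms have degree at least `m`. -/
theorem prod_sum_eq_sum_cauchyIndex {R : Type*} [CommSemiring R] (δ : Fin m → ℕ)
    (a : Fin m → ℕ → R) (x : R) :
    ∏ s, ∑ k ∈ Finset.Icc 1 (δ s), a s k * x ^ k =
      ∑ k ∈ Finset.Icc m (∑ s, δ s), (∑ j ∈ cauchyIndex δ k, ∏ s, a s (j s)) * x ^ k := by
  rw [Finset.prod_univ_sum, ← Finset.sum_fiberwise_of_maps_to (g := fun j => ∑ s, j s)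
    (t := Finset.Icc m (∑ s, δ s))]
  · refine Finset.sum_congr rfl fun k _ => ?_
    rw [Finset.sum_mul]
    refine Finset.sum_congr rfl fun j hj => ?_
    rw [Finset.prod_mul_distrib, Finset.prod_pow_eq_pow_sum, (mem_cauchyIndex.1 hj).2]
  · intro j hj
    exact mem_Icc_of_mem_cauchyIndex (δ := δ) (mem_cauchyIndex.2
      ⟨fun s => Finset.mem_Icc.1 (Fintype.mem_piFinset.1 hj s), rfl⟩)

theorem coeff_prod_eq_sum_cauchyIndex {p : Fin m → PowerSeries ℝ}
    (hp : ∀ s, ∀ k ∉ Finset.Icc 1 (δ s), PowerSeries.coeff k (p s) = 0) (k : ℕ) :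
    PowerSeries.coeff k (∏ s, p s) =
      ∑ j ∈ cauchyIndex δ k, ∏ s, PowerSeries.coeff (j s) (p s) := by
  -- by the hypothesis each factor is a polynomial, with terms of degree `1` to `δ s` only
  have hexp : ∀ s, p s = ∑ k ∈ Finset.Icc 1 (δ s),
      PowerSeries.C (PowerSeries.coeff k (p s)) * PowerSeries.X ^ k := fun s => by
    ext k
    simp only [map_sum, PowerSeries.coeff_C_mul, PowerSeries.coeff_X_pow, mul_ite, mul_one,
      mul_zero, Finset.sum_ite_eq]
    split_ifs with h
    · rfl
    · exact hp s k h
  rw [Finset.prod_congr rfl fun s _ => hexp s, prod_sum_eq_sum_cauchyIndex]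
  simp only [← map_prod, ← map_sum (PowerSeries.C (R := ℝ))]
  rw [map_sum]
  simp only [PowerSeries.coeff_C_mul, PowerSeries.coeff_X_pow, mul_ite, mul_one, mul_zero,
    Finset.sum_ite_eq]
  split_ifs with h
  · rfl
  · rw [sum_cauchyIndex_eq_zero h]

end cauchyIndex

/-! ### The coefficients of the nested copula -/

theorem IsBellFamily.congr {ι : Type*} [DecidableEq ι] {T T' : (ι → ℝ) → ℝ}
    {P : List ι → (ι → ℝ) → PowerSeries ℝ} (hP : IsBellFamily T P)
    (h : ∀ w ∈ openCube ι, T' w = T w) : IsBellFamily T' P where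
  nil := hP.nil
  cons i L hL w hw := by
    obtain ⟨τ, q, hτ, hq⟩ := hP.cons i L hL w hw
    exact ⟨τ, q, hτ.congr_of_eventuallyEq
      ((eventually_update_mem_openCube hw i).mono fun y hy => h _ hy), hq⟩

theorem iteratedPartial_congr {ι : Type*} [DecidableEq ι] {F G : (ι → ℝ) → ℝ}
    (h : ∀ w ∈ openCube ι, F w = G w) (L : List ι) {w : ι → ℝ} (hw : w ∈ openCube ι) :
    iteratedPartial L F w = iteratedPartial L G w := by
  induction L generalizing w with
  | nil => exact h w hw
  | cons i L ih =>
    exact Filter.EventuallyEq.deriv_eq (f := fun y => iteratedPartial L G (Function.update w i y))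
      (f₁ := fun y => iteratedPartial L F (Function.update w i y))
      ((eventually_update_mem_openCube hw i).mono fun y hy => ih hy)

section coeff

variable {m : ℕ} {δ : Fin m → ℕ} {ψ₁ ψ₀ : ℝ → ℝ} {ψ : Fin m → ℝ → ℝ}

theorem coeffA_eq_zero (hm : 1 ≤ m) (ψ₁ ψ₀ : ℝ → ℝ) (ψ : Fin m → ℝ → ℝ) {k : ℕ}
    (hk : k ∉ Finset.Icc 1 (∑ s, δ s)) (t : Fin m → ℝ) : coeffA δ ψ₁ ψ₀ ψ k t = 0 := by
  refine Finset.sum_eq_zero fun l hl => ?_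
  rw [Finset.mem_Icc] at hl hk
  have hk0 : k = 0 := by omega
  rcases eq_or_ne l 0 with rfl | h
  · rw [sum_cauchyIndex_eq_zero (by simp; omega), mul_zero]
  · rw [hk0, coeffNode, bell_zero_right h, zero_mul]

/-- The series describing the mixed partial derivatives of functions of `t*`. -/
theorem exists_isBellFamily_tStar (hδ : ∀ s, 1 ≤ δ s) (hψ₀ : IsGenerator ψ₀)
    (hψ : ∀ s, IsGenerator (ψ s)) :
    ∃ P, IsBellFamily (fun w : (Σ s, Fin (δ s)) → ℝ => tStar ψ₀ ψ w) P ∧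
      ∀ L, IsEnumeration L → ∀ w ∈ openCube (Σ s, Fin (δ s)), ∀ l,
        PowerSeries.coeff l (P L w) = (∏ s, ∏ j, deriv (genInv (ψ s)) (w ⟨s, j⟩)) *
          ∑ j ∈ cauchyIndex δ l, ∏ s, coeffNode ψ₀ (ψ s) (δ s) (j s) (tVec ψ w s) := by
  have hbase : ∀ s, IsBellFamily (fun w : Fin (δ s) → ℝ => ∑ i, genInv (ψ s) (w i)) _ := fun s =>
    IsBellFamily.sum_apply ((hψ s).contDiffOn_genInv.differentiableOn (by simp))
  have hpos : ∀ s, ∀ w ∈ openCube (Fin (δ s)), 0 < ∑ i, genInv (ψ s) (w i) := fun s w hw =>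
    have : Nonempty (Fin (δ s)) := ⟨⟨0, hδ s⟩⟩
    sum_genInv_pos (hψ s) hw
  refine ⟨_, (IsBellFamily.sum_blocks fun s => (hbase s).comp (hpos s)
    (hψ₀.contDiffOn_node (hψ s))).congr fun w hw => tStar_eq hψ₀ hψ (openCube_subset hw), ?_⟩
  intro L hL w hw l
  have hlen : ∀ s, (blockList s L).length = δ s := fun s => by
    rw [(hL.blockList s).length_eq, Fintype.card_fin]
  have hfac : ∀ s, ∑ l ∈ Finset.range ((blockList s L).length + 1),
      PowerSeries.C (PowerSeries.coeff l (PowerSeries.C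
        ((blockList s L).map fun i => deriv (genInv (ψ s)) (w ⟨s, i⟩)).prod *
          PowerSeries.X ^ (blockList s L).length)) *
        bellSeries l (fun r => iteratedDeriv r (node ψ₀ (ψ s)) (∑ i, genInv (ψ s) (w ⟨s, i⟩))) =
      PowerSeries.C (∏ j, deriv (genInv (ψ s)) (w ⟨s, j⟩)) *
        bellSeries (δ s) fun r => iteratedDeriv r (node ψ₀ (ψ s)) (tVec ψ w s) := fun s => by
    rw [hlen, (hL.blockList s).prod_map, Finset.sum_eq_single (δ s)]
    · simp only [PowerSeries.coeff_C_mul, PowerSeries.coeff_X_pow_self, mul_one, tVec]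
    · intro b _ hb
      rw [PowerSeries.coeff_C_mul, PowerSeries.coeff_X_pow, if_neg hb, mul_zero, map_zero, zero_mul]
    · simp
  rw [Finset.prod_congr rfl fun s _ => hfac s, Finset.prod_mul_distrib, ← map_prod,
    PowerSeries.coeff_C_mul, coeff_prod_eq_sum_cauchyIndex (δ := δ)]
  · simp only [bellSeries, PowerSeries.coeff_mk, coeffNode]
  · intro s k hk
    rw [bellSeries, PowerSeries.coeff_mk]
    rw [Finset.mem_Icc] at hk
    rcases Nat.eq_zero_or_pos k with rfl | h
    · exact bell_zero_right (by have := hδ s; omega) _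
    · exact bell_eq_zero_of_lt (by omega) _

/-- The series describing the mixed partial derivatives of functions of `ψ₁⁻¹ ∘ ψ₀ ∘ t*`. -/
theorem exists_isBellFamily_branch (hm : 1 ≤ m) (hδ : ∀ s, 1 ≤ δ s) (hψ₁ : IsGenerator ψ₁)
    (hψ₀ : IsGenerator ψ₀) (hψ : ∀ s, IsGenerator (ψ s)) :
    ∃ P, IsBellFamily (fun w : (Σ s, Fin (δ s)) → ℝ => node ψ₁ ψ₀ (tStar ψ₀ ψ w)) P ∧
      ∀ L, IsEnumeration L → ∀ w ∈ openCube (Σ s, Fin (δ s)), ∀ k,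
        PowerSeries.coeff k (P L w) = (∏ s, ∏ j, deriv (genInv (ψ s)) (w ⟨s, j⟩)) *
          coeffA δ ψ₁ ψ₀ ψ k (tVec ψ w) := by
  obtain ⟨P, hP, hcoeff⟩ := exists_isBellFamily_tStar hδ hψ₀ hψ
  refine ⟨_, hP.comp (fun w hw => tStar_pos hm hδ hψ₀ hψ hw) (hψ₁.contDiffOn_node hψ₀), ?_⟩
  intro L hL w hw k
  have hlen : L.length = ∑ s, δ s := by
    rw [hL.length_eq, Fintype.card_sigma]; simp
  have hsub : Finset.Icc k (∑ s, δ s) ⊆ Finset.range (∑ s, δ s + 1) :=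
    Icc_subset_range_succ _ _
  rw [hlen, map_sum]
  simp only [PowerSeries.coeff_C_mul, hcoeff L hL w hw, bellSeries, PowerSeries.coeff_mk]
  rw [coeffA, Finset.mul_sum, ← Finset.sum_subset hsub]
  · refine Finset.sum_congr rfl fun l _ => ?_
    rw [coeffNode, ← tStar_eq hψ₀ hψ (openCube_subset hw)]
    ring
  · intro l hl hl'
    rw [Finset.mem_range] at hl
    rw [Finset.mem_Icc] at hl'
    rw [bell_eq_zero_of_lt (by omega), mul_zero]

/-- The coefficient has sign `(-1)^{n-k}` with `n = ∑ δ`. -/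
theorem coeffA_sign (h₁ : IsCompletelyMonotone (deriv (node ψ₁ ψ₀)))
    (h : ∀ s, IsCompletelyMonotone (deriv (node ψ₀ (ψ s)))) (k : ℕ) {t : Fin m → ℝ}
    (ht : ∀ s, 0 < t s) (ht' : 0 < ∑ s, node ψ₀ (ψ s) (t s)) :
    0 ≤ (-1) ^ (∑ s, δ s + k) * coeffA δ ψ₁ ψ₀ ψ k t := by
  rw [coeffA, Finset.mul_sum]
  refine Finset.sum_nonneg fun l _ => ?_
  have h2 : (0 : ℝ) ≤ (-1) ^ (∑ s, δ s + l) *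
      ∑ j ∈ cauchyIndex δ l, ∏ s, coeffNode ψ₀ (ψ s) (δ s) (j s) (t s) := by
    rw [Finset.mul_sum]
    refine Finset.sum_nonneg fun j hj => ?_
    rw [← (mem_cauchyIndex.1 hj).2, ← Finset.sum_add_distrib, ← Finset.prod_pow_eq_pow_sum,
      ← Finset.prod_mul_distrib]
    exact Finset.prod_nonneg fun s _ => coeffNode_sign (h s) _ _ (ht s)
  have h3 : (-1 : ℝ) ^ (∑ s, δ s + k) = (-1) ^ (l + k) * (-1) ^ (∑ s, δ s + l) := by
    rw [← pow_add, show l + k + (∑ s, δ s + l) = ∑ s, δ s + k + 2 * l by ring, pow_add _ _ (2 * l),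
      pow_mul]
    simp
  rw [h3, mul_mul_mul_comm]
  exact mul_nonneg (coeffNode_sign h₁ l k ht') h2

end coeff

/-! ### Inner generators -/

theorem iteratedDeriv_exp_neg_mul (v : ℝ) (k : ℕ) (t : ℝ) :
    iteratedDeriv k (fun x => Real.exp (-v * x)) t = (-v) ^ k * Real.exp (-v * t) := by
  simpa using congrFun (iteratedDeriv_exp_const_mul k (-v)) t

section inner

variable {m : ℕ} {δ : Fin m → ℕ} {ψ₁ ψ₀ : ℝ → ℝ} {ψ : Fin m → ℝ → ℝ}

theorem contDiffOn_node_tStar (hm : 1 ≤ m) (hδ : ∀ s, 1 ≤ δ s) (hψ₁ : IsGenerator ψ₁)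
    (hψ₀ : IsGenerator ψ₀) (hψ : ∀ s, IsGenerator (ψ s)) :
    ContDiffOn ℝ ∞ (fun w : (Σ s, Fin (δ s)) → ℝ => node ψ₁ ψ₀ (tStar ψ₀ ψ w)) (openCube _) :=
  (hψ₁.contDiffOn_node hψ₀).comp (contDiffOn_tStar hδ hψ₀ hψ) fun _ hw =>
    tStar_pos hm hδ hψ₀ hψ hw

theorem hasMixedPartialOn_innerGenerator (hm : 1 ≤ m) (hδ : ∀ s, 1 ≤ δ s) (hψ₁ : IsGenerator ψ₁)
    (hψ₀ : IsGenerator ψ₀) (hψ : ∀ s, IsGenerator (ψ s)) (v : ℝ) :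
    HasMixedPartialOn
      (fun w : (Σ s, Fin (δ s)) → ℝ => innerGenerator ψ₁ ψ₀ v (tStar ψ₀ ψ w))
      (fun w => (∏ s, ∏ j, deriv (genInv (ψ s)) (w ⟨s, j⟩)) *
        innerGenerator ψ₁ ψ₀ v (tStar ψ₀ ψ w) *
        ∑ k ∈ Finset.Icc 1 (∑ s, δ s), coeffA δ ψ₁ ψ₀ ψ k (tVec ψ w) * (-v) ^ k)
      (openCube _) := by
  refine ⟨?_, fun L hL w hw => ?_⟩
  · exact Real.contDiff_exp.comp_contDiffOn
      (contDiffOn_const.mul (contDiffOn_node_tStar hm hδ hψ₁ hψ₀ hψ))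
  · obtain ⟨P, hP, hcoeff⟩ := exists_isBellFamily_branch hm hδ hψ₁ hψ₀ hψ
    have hlen : L.length = ∑ s, δ s := by
      rw [hL.length_eq, Fintype.card_sigma]; simp
    have hsmooth : ContDiffOn ℝ ∞ (fun x => Real.exp (-v * x)) (Ioi 0) := by fun_prop
    have hsub : Finset.Icc 1 (∑ s, δ s) ⊆ Finset.range (∑ s, δ s + 1) :=
      Icc_subset_range_succ _ _
    refine (hP.iteratedPartial_comp (fun w hw => hψ₁.node_pos hψ₀ (tStar_pos hm hδ hψ₀ hψ hw))
      hsmooth hL.1 hw hlen.le).trans ?_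
    simp only [hcoeff L hL w hw, iteratedDeriv_exp_neg_mul]
    rw [← Finset.sum_subset hsub fun k _ hk => by rw [coeffA_eq_zero hm _ _ _ hk]; ring,
      Finset.mul_sum]
    exact Finset.sum_congr rfl fun k _ => by rw [innerGenerator]; ring

end inner

/-! ### The density of the three-level copula -/

section density

variable {d₁ : ℕ} {d₂ : Fin d₁ → ℕ} {d₃ : (s₂ : Fin d₁) → Fin (d₂ s₂) → ℕ}
  {ψ₁ : ℝ → ℝ} {ψ₂ : Fin d₁ → ℝ → ℝ} {ψ₃ : (s₂ : Fin d₁) → Fin (d₂ s₂) → ℝ → ℝ}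

/-- The explicit mixed partial derivative of the three-level nested Archimedean copula. -/
noncomputable def nestedDensity (d₃ : (s₂ : Fin d₁) → Fin (d₂ s₂) → ℕ) (ψ₁ : ℝ → ℝ) (ψ₂ : Fin d₁ → ℝ → ℝ)
    (ψ₃ : (s₂ : Fin d₁) → Fin (d₂ s₂) → ℝ → ℝ)
    (u : (Σ s₂ : Fin d₁, Σ s₃ : Fin (d₂ s₂), Fin (d₃ s₂ s₃)) → ℝ) : ℝ :=
  (∏ s₂, ∏ s₃, ∏ s₄, deriv (genInv (ψ₃ s₂ s₃)) (u ⟨s₂, s₃, s₄⟩)) *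
    ∑ k ∈ Finset.Icc d₁ (∑ s₂, ∑ s₃, d₃ s₂ s₃),
      coeffB d₃ ψ₁ ψ₂ ψ₃ k (fun s₂ => tVec (ψ₃ s₂) fun p => u ⟨s₂, p⟩) *
        iteratedDeriv k ψ₁ (genInv ψ₁ (nestedCopula₃ ψ₁ ψ₂ ψ₃ u))

theorem genInv_nestedCopula₃_pos (hd₁ : 1 ≤ d₁) (hd₂ : ∀ s₂, 1 ≤ d₂ s₂)
    (hd₃ : ∀ s₂ s₃, 1 ≤ d₃ s₂ s₃) (hψ₁ : IsGenerator ψ₁) (hψ₂ : ∀ s₂, IsGenerator (ψ₂ s₂))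
    (hψ₃ : ∀ s₂ s₃, IsGenerator (ψ₃ s₂ s₃))
    {u : (Σ s₂ : Fin d₁, Σ s₃ : Fin (d₂ s₂), Fin (d₃ s₂ s₃)) → ℝ} (hu : u ∈ openCube _) :
    0 < genInv ψ₁ (nestedCopula₃ ψ₁ ψ₂ ψ₃ u) := by
  have : Nonempty (Fin d₁) := ⟨⟨0, hd₁⟩⟩
  rw [genInv_nestedCopula₃ hψ₁ hψ₂ hψ₃ (openCube_subset hu)]
  exact Finset.sum_pos (fun s₂ _ => hψ₁.node_pos (hψ₂ s₂)
    (tStar_pos (hd₂ s₂) (hd₃ s₂) (hψ₂ s₂) (hψ₃ s₂) fun p => hu ⟨s₂, p⟩)) Finset.univ_nonempty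

theorem hasMixedPartialOn_nestedCopula₃ (hd₁ : 1 ≤ d₁) (hd₂ : ∀ s₂, 1 ≤ d₂ s₂)
    (hd₃ : ∀ s₂ s₃, 1 ≤ d₃ s₂ s₃) (hψ₁ : IsGenerator ψ₁) (hψ₂ : ∀ s₂, IsGenerator (ψ₂ s₂))
    (hψ₃ : ∀ s₂ s₃, IsGenerator (ψ₃ s₂ s₃)) :
    HasMixedPartialOn (nestedCopula₃ ψ₁ ψ₂ ψ₃) (nestedDensity d₃ ψ₁ ψ₂ ψ₃) (openCube _) := by
  refine ⟨contDiffOn_nestedCopula₃ hd₁ hd₂ hd₃ hψ₁ hψ₂ hψ₃, fun L hL u hu => ?_⟩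
  choose P hP hcoeff using fun s₂ =>
    exists_isBellFamily_branch (hd₂ s₂) (hd₃ s₂) hψ₁ (hψ₂ s₂) (hψ₃ s₂)
  have hT := (IsBellFamily.sum_blocks hP).congr
    (T' := fun u => genInv ψ₁ (nestedCopula₃ ψ₁ ψ₂ ψ₃ u))
    fun u hu => genInv_nestedCopula₃ hψ₁ hψ₂ hψ₃ (openCube_subset hu)
  have hlen : L.length = ∑ s₂, ∑ s₃, d₃ s₂ s₃ := by
    rw [hL.length_eq, Fintype.card_sigma]
    exact Finset.sum_congr rfl fun s₂ _ => by rw [Fintype.card_sigma]; simp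
  have hC : iteratedPartial L (nestedCopula₃ ψ₁ ψ₂ ψ₃) u = iteratedPartial L
      (fun u => ψ₁ (genInv ψ₁ (nestedCopula₃ ψ₁ ψ₂ ψ₃ u))) u :=
    iteratedPartial_congr (fun u hu => (hψ₁.apply_genInv
      (nestedCopula₃_mem_Ioc hψ₁ hψ₂ hψ₃ (openCube_subset hu))).symm) L hu
  rw [hC, hT.iteratedPartial_comp
    (fun u hu => genInv_nestedCopula₃_pos hd₁ hd₂ hd₃ hψ₁ hψ₂ hψ₃ hu)
    hψ₁.completelyMonotone.smooth hL.1 hu hlen.le]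
  have hk : ∀ k, PowerSeries.coeff k (∏ s₂, P s₂ (blockList s₂ L) fun p => u ⟨s₂, p⟩) =
      (∏ s₂, ∏ s₃, ∏ s₄, deriv (genInv (ψ₃ s₂ s₃)) (u ⟨s₂, s₃, s₄⟩)) *
        coeffB d₃ ψ₁ ψ₂ ψ₃ k fun s₂ => tVec (ψ₃ s₂) fun p => u ⟨s₂, p⟩ := by
    intro k
    have hc : ∀ s₂ k, PowerSeries.coeff k (P s₂ (blockList s₂ L) fun p => u ⟨s₂, p⟩) = _ :=
      fun s₂ k => hcoeff s₂ (blockList s₂ L) (hL.blockList s₂) (fun p => u ⟨s₂, p⟩)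
        (fun p => hu ⟨s₂, p⟩) k
    rw [coeff_prod_eq_sum_cauchyIndex (δ := fun s₂ => ∑ s₃, d₃ s₂ s₃), coeffB, Finset.mul_sum]
    · refine Finset.sum_congr rfl fun j _ => ?_
      rw [← Finset.prod_mul_distrib]
      exact Finset.prod_congr rfl fun s₂ _ => hc s₂ (j s₂)
    · intro s₂ k hk
      rw [hc, coeffA_eq_zero (hd₂ s₂) _ _ _ hk, mul_zero]
  have hsub : Finset.Icc d₁ (∑ s₂, ∑ s₃, d₃ s₂ s₃) ⊆
      Finset.range (∑ s₂, ∑ s₃, d₃ s₂ s₃ + 1) :=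
    Icc_subset_range_succ _ _
  simp only [hk]
  rw [nestedDensity, Finset.mul_sum, ← Finset.sum_subset hsub fun k _ hk => by
    rw [coeffB, sum_cauchyIndex_eq_zero hk]; ring]
  exact Finset.sum_congr rfl fun k _ => by ring

/-- The density is nonnegative: the factors `(ψ⁻¹)'`, the coefficients `b_k` and the derivatives
`ψ₁^{(k)}` have the signs `(-1)^d`, `(-1)^{d-k}` and `(-1)^k`. -/
theorem nestedDensity_nonneg (hd₁ : 1 ≤ d₁) (hd₂ : ∀ s₂, 1 ≤ d₂ s₂)
    (hd₃ : ∀ s₂ s₃, 1 ≤ d₃ s₂ s₃) (hψ₁ : IsGenerator ψ₁) (hψ₂ : ∀ s₂, IsGenerator (ψ₂ s₂))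
    (hψ₃ : ∀ s₂ s₃, IsGenerator (ψ₃ s₂ s₃))
    (hnode₂ : ∀ s₂, IsCompletelyMonotone (deriv (node ψ₁ (ψ₂ s₂))))
    (hnode₃ : ∀ s₂ s₃, IsCompletelyMonotone (deriv (node (ψ₂ s₂) (ψ₃ s₂ s₃))))
    {u : (Σ s₂ : Fin d₁, Σ s₃ : Fin (d₂ s₂), Fin (d₃ s₂ s₃)) → ℝ} (hu : u ∈ openCube _) :
    0 ≤ nestedDensity d₃ ψ₁ ψ₂ ψ₃ u := by
  set d := ∑ s₂, ∑ s₃, d₃ s₂ s₃ with hd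
  set D := ∏ s₂, ∏ s₃, ∏ s₄, deriv (genInv (ψ₃ s₂ s₃)) (u ⟨s₂, s₃, s₄⟩) with hD
  have hD0 : 0 ≤ (-1) ^ d * D := by
    have : (-1) ^ d * D = ∏ s₂, ∏ s₃, ∏ s₄, -deriv (genInv (ψ₃ s₂ s₃)) (u ⟨s₂, s₃, s₄⟩) := by
      simp only [Finset.prod_neg, Finset.prod_mul_distrib, Finset.prod_pow_eq_pow_sum,
        Finset.card_univ, Fintype.card_fin, hd, hD]
    rw [this]
    exact Finset.prod_nonneg fun s₂ _ => Finset.prod_nonneg fun s₃ _ => Finset.prod_nonneg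
      fun s₄ _ => neg_nonneg.2 ((hψ₃ s₂ s₃).deriv_genInv_nonpos (hu _))
  have hB : ∀ k, 0 ≤ (-1) ^ (d + k) *
      coeffB d₃ ψ₁ ψ₂ ψ₃ k fun s₂ => tVec (ψ₃ s₂) fun p => u ⟨s₂, p⟩ := by
    intro k
    rw [coeffB, Finset.mul_sum]
    refine Finset.sum_nonneg fun j hj => ?_
    rw [← (mem_cauchyIndex.1 hj).2, hd, ← Finset.sum_add_distrib, ← Finset.prod_pow_eq_pow_sum,
      ← Finset.prod_mul_distrib]
    refine Finset.prod_nonneg fun s₂ _ => coeffA_sign (hnode₂ s₂) (hnode₃ s₂) _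
      (fun s₃ => tVec_pos (hd₃ s₂) (hψ₃ s₂) (fun p => hu ⟨s₂, p⟩) s₃) ?_
    rw [← tStar_eq (hψ₂ s₂) (hψ₃ s₂) fun p => openCube_subset hu ⟨s₂, p⟩]
    exact tStar_pos (hd₂ s₂) (hd₃ s₂) (hψ₂ s₂) (hψ₃ s₂) fun p => hu ⟨s₂, p⟩
  rw [nestedDensity, Finset.mul_sum]
  refine Finset.sum_nonneg fun k _ => ?_
  have h := mul_nonneg hD0 (mul_nonneg (hB k) (hψ₁.completelyMonotone.sign k _
    (genInv_nestedCopula₃_pos hd₁ hd₂ hd₃ hψ₁ hψ₂ hψ₃ hu)))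
  have hs : (-1 : ℝ) ^ d * ((-1) ^ (d + k) * (-1) ^ k) = 1 := by
    rw [← pow_add, ← pow_add, show d + (d + k + k) = 2 * (d + k) by ring, pow_mul]
    simp
  refine h.trans_eq ?_
  calc _ = ((-1) ^ d * ((-1) ^ (d + k) * (-1) ^ k)) * (D *
        (coeffB d₃ ψ₁ ψ₂ ψ₃ k (fun s₂ => tVec (ψ₃ s₂) fun p => u ⟨s₂, p⟩) *
          iteratedDeriv k ψ₁ (genInv ψ₁ (nestedCopula₃ ψ₁ ψ₂ ψ₃ u)))) := by ring
    _ = _ := by rw [hs, one_mul]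

theorem isDensityOf_nestedDensity (hd₁ : 1 ≤ d₁) (hd₂ : ∀ s₂, 1 ≤ d₂ s₂)
    (hd₃ : ∀ s₂ s₃, 1 ≤ d₃ s₂ s₃) (hψ₁ : IsGenerator ψ₁) (hψ₂ : ∀ s₂, IsGenerator (ψ₂ s₂))
    (hψ₃ : ∀ s₂ s₃, IsGenerator (ψ₃ s₂ s₃))
    (hnode₂ : ∀ s₂, IsCompletelyMonotone (deriv (node ψ₁ (ψ₂ s₂))))
    (hnode₃ : ∀ s₂ s₃, IsCompletelyMonotone (deriv (node (ψ₂ s₂) (ψ₃ s₂ s₃)))) :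
    IsDensityOf (nestedDensity d₃ ψ₁ ψ₂ ψ₃) (nestedCopula₃ ψ₁ ψ₂ ψ₃) := by
  obtain ⟨L, hL⟩ := exists_isEnumeration (Σ s₂ : Fin d₁, Σ s₃ : Fin (d₂ s₂), Fin (d₃ s₂ s₃))
  obtain ⟨hsmooth, hpartial⟩ := hasMixedPartialOn_nestedCopula₃ hd₁ hd₂ hd₃ hψ₁ hψ₂ hψ₃
  exact isDensityOf_of_iteratedPartial hsmooth (continuousOn_nestedCopula₃ hψ₁ hψ₂ hψ₃)
    (fun u hu => nestedCopula₃_nonneg hψ₁ hψ₂ hψ₃ hu)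
    (fun u hu => nestedCopula₃_le hψ₁ hψ₂ hψ₃ hu) hL (hpartial L hL)
    fun u hu => nestedDensity_nonneg hd₁ hd₂ hd₃ hψ₁ hψ₂ hψ₃ hnode₂ hnode₃ hu

/-! ### The mixture representation -/

theorem IsLaplaceInverse.mem_interior {F : Measure ℝ} {ψ : ℝ → ℝ} (hF : IsLaplaceInverse F ψ)
    {t : ℝ} (ht : 0 < t) : -t ∈ interior (ProbabilityTheory.integrableExpSet id F) := by
  have := hF.1
  have hsub : Iio (0 : ℝ) ⊆ ProbabilityTheory.integrableExpSet id F := fun s hs => by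
    refine Integrable.of_bound (C := 1) (by fun_prop) ?_
    have h0 : ∀ᵐ v ∂F, v ∉ Iic (0 : ℝ) := measure_eq_zero_iff_ae_notMem.1 hF.2.1
    filter_upwards [h0] with v hv
    rw [Real.norm_eq_abs, Real.abs_exp, Real.exp_le_one_iff]
    exact mul_nonpos_of_nonpos_of_nonneg hs.le (not_le.1 hv).le
  exact interior_mono hsub (by rw [interior_Iio]; exact neg_lt_zero.2 ht)

/-- Derivatives of a Laplace–Stieltjes transform are computed under the integral sign. -/
theorem IsLaplaceInverse.iteratedDeriv_eq {F : Measure ℝ} {ψ : ℝ → ℝ} (hF : IsLaplaceInverse F ψ)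
    {t : ℝ} (ht : 0 < t) (k : ℕ) :
    Integrable (fun v => (-v) ^ k * Real.exp (-v * t)) F ∧
      iteratedDeriv k ψ t = ∫ v, (-v) ^ k * Real.exp (-v * t) ∂F := by
  have hfun : (fun v : ℝ => (-v) ^ k * Real.exp (-v * t)) =
      fun v => (-1) ^ k * (v ^ k * Real.exp (-t * v)) := by
    funext v
    rw [neg_pow, mul_assoc, neg_mul_comm, mul_neg, neg_mul, mul_comm t]
  have hev : ψ =ᶠ[𝓝 t] fun s => ProbabilityTheory.mgf id F (-s) :=
    (lt_mem_nhds ht).mono fun s hs => by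
      rw [← hF.2.2 s hs.le]
      exact integral_congr_ae (.of_forall fun v => by simp [mul_comm])
  constructor
  · rw [hfun]
    exact (ProbabilityTheory.integrable_pow_mul_exp_of_mem_interior_integrableExpSet
      (hF.mem_interior ht) k).const_mul _
  · rw [hev.iteratedDeriv_eq, iteratedDeriv_comp_neg,
      ProbabilityTheory.iteratedDeriv_mgf (hF.mem_interior ht), hfun, integral_const_mul,
      smul_eq_mul]
    rfl

theorem nestedDensity_eq_integral (hd₁ : 1 ≤ d₁) (hd₂ : ∀ s₂, 1 ≤ d₂ s₂)
    (hd₃ : ∀ s₂ s₃, 1 ≤ d₃ s₂ s₃) (hψ₁ : IsGenerator ψ₁) (hψ₂ : ∀ s₂, IsGenerator (ψ₂ s₂))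
    (hψ₃ : ∀ s₂ s₃, IsGenerator (ψ₃ s₂ s₃)) {F : Measure ℝ} (hF : IsLaplaceInverse F ψ₁)
    {L : (s₂ : Fin d₁) → List (Σ s₃ : Fin (d₂ s₂), Fin (d₃ s₂ s₃))}
    (hL : ∀ s₂, IsEnumeration (L s₂))
    {u : (Σ s₂ : Fin d₁, Σ s₃ : Fin (d₂ s₂), Fin (d₃ s₂ s₃)) → ℝ} (hu : u ∈ openCube _) :
    Integrable (fun v => ∏ s₂, iteratedPartial (L s₂)
        (fun w => innerGenerator ψ₁ (ψ₂ s₂) v (tStar (ψ₂ s₂) (ψ₃ s₂) w))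
        (fun p => u ⟨s₂, p⟩)) F ∧
      nestedDensity d₃ ψ₁ ψ₂ ψ₃ u = ∫ v, ∏ s₂, iteratedPartial (L s₂)
        (fun w => innerGenerator ψ₁ (ψ₂ s₂) v (tStar (ψ₂ s₂) (ψ₃ s₂) w))
        (fun p => u ⟨s₂, p⟩) ∂F := by
  set D := ∏ s₂, ∏ s₃, ∏ s₄, deriv (genInv (ψ₃ s₂ s₃)) (u ⟨s₂, s₃, s₄⟩) with hD
  set t := genInv ψ₁ (nestedCopula₃ ψ₁ ψ₂ ψ₃ u) with ht
  have hprod : ∀ v : ℝ, ∏ s₂, iteratedPartial (L s₂)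
      (fun w => innerGenerator ψ₁ (ψ₂ s₂) v (tStar (ψ₂ s₂) (ψ₃ s₂) w)) (fun p => u ⟨s₂, p⟩) =
      ∑ k ∈ Finset.Icc d₁ (∑ s₂, ∑ s₃, d₃ s₂ s₃),
        D * coeffB d₃ ψ₁ ψ₂ ψ₃ k (fun s₂ => tVec (ψ₃ s₂) fun p => u ⟨s₂, p⟩) *
          ((-v) ^ k * Real.exp (-v * t)) := by
    intro v
    have hexp : Real.exp (-v * t) = ∏ s₂, innerGenerator ψ₁ (ψ₂ s₂) v
        (tStar (ψ₂ s₂) (ψ₃ s₂) fun p => u ⟨s₂, p⟩) := by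
      rw [ht, genInv_nestedCopula₃ hψ₁ hψ₂ hψ₃ (openCube_subset hu), Finset.mul_sum, Real.exp_sum]
      rfl
    rw [Finset.prod_congr rfl fun s₂ _ => (hasMixedPartialOn_innerGenerator (hd₂ s₂) (hd₃ s₂) hψ₁
      (hψ₂ s₂) (hψ₃ s₂) v).2 (L s₂) (hL s₂) (fun p => u ⟨s₂, p⟩) fun p => hu ⟨s₂, p⟩,
      Finset.prod_mul_distrib, Finset.prod_mul_distrib, ← hexp, ← hD,
      prod_sum_eq_sum_cauchyIndex, Finset.mul_sum]
    exact Finset.sum_congr rfl fun k _ => by rw [coeffB]; ring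
  have hder := hF.iteratedDeriv_eq
    (genInv_nestedCopula₃_pos hd₁ hd₂ hd₃ hψ₁ hψ₂ hψ₃ hu)
  simp only [hprod]
  constructor
  · exact integrable_finsetSum _ fun k _ => (hder k).1.const_mul _
  · rw [integral_finsetSum _ fun k _ => (hder k).1.const_mul _, nestedDensity, Finset.mul_sum]
    refine Finset.sum_congr rfl fun k _ => ?_
    rw [integral_const_mul, (hder k).2]
    ring

end density

theorem mainTheorem5
    (d₁ : ℕ) (d₂ : Fin d₁ → ℕ) (d₃ : (s₂ : Fin d₁) → Fin (d₂ s₂) → ℕ)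
    (hd₁ : 1 ≤ d₁) (hd₂ : ∀ s₂, 1 ≤ d₂ s₂) (hd₃ : ∀ s₂ s₃, 1 ≤ d₃ s₂ s₃)
    (ψ₁ : ℝ → ℝ) (ψ₂ : Fin d₁ → ℝ → ℝ) (ψ₃ : (s₂ : Fin d₁) → Fin (d₂ s₂) → ℝ → ℝ)
    (hψ₁ : IsGenerator ψ₁) (hψ₂ : ∀ s₂, IsGenerator (ψ₂ s₂))
    (hψ₃ : ∀ s₂ s₃, IsGenerator (ψ₃ s₂ s₃))
    (hnode₂ : ∀ s₂, IsCompletelyMonotone (deriv (node ψ₁ (ψ₂ s₂))))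
    (hnode₃ : ∀ s₂ s₃, IsCompletelyMonotone (deriv (node (ψ₂ s₂) (ψ₃ s₂ s₃)))) :
    -- derivatives of the inner generators
    (∀ (s₂ : Fin d₁) (v : ℝ), 0 < v →
      HasMixedPartialOn
        (fun w : (Σ s₃ : Fin (d₂ s₂), Fin (d₃ s₂ s₃)) → ℝ =>
          innerGenerator ψ₁ (ψ₂ s₂) v (tStar (ψ₂ s₂) (ψ₃ s₂) w))
        (fun w =>
          (∏ s₃, ∏ s₄, deriv (genInv (ψ₃ s₂ s₃)) (w ⟨s₃, s₄⟩)) *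
            innerGenerator ψ₁ (ψ₂ s₂) v (tStar (ψ₂ s₂) (ψ₃ s₂) w) *
            ∑ k ∈ Finset.Icc 1 (∑ s₃, d₃ s₂ s₃),
              coeffA (d₃ s₂) ψ₁ (ψ₂ s₂) (ψ₃ s₂) k (tVec (ψ₃ s₂) w) * (-v) ^ k)
        (openCube _)) ∧
    -- the density
    ∃ c : ((Σ s₂ : Fin d₁, Σ s₃ : Fin (d₂ s₂), Fin (d₃ s₂ s₃)) → ℝ) → ℝ,
      IsDensityOf c (nestedCopula₃ ψ₁ ψ₂ ψ₃) ∧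
      HasMixedPartialOn (nestedCopula₃ ψ₁ ψ₂ ψ₃) c (openCube _) ∧
      -- representation as a mixture
      (∀ F : Measure ℝ, IsLaplaceInverse F ψ₁ →
        ∀ L : (s₂ : Fin d₁) → List (Σ s₃ : Fin (d₂ s₂), Fin (d₃ s₂ s₃)),
        (∀ s₂, IsEnumeration (L s₂)) → ∀ u ∈ openCube _,
          Integrable (fun v => ∏ s₂, iteratedPartial (L s₂)
            (fun w => innerGenerator ψ₁ (ψ₂ s₂) v (tStar (ψ₂ s₂) (ψ₃ s₂) w))
            (fun p => u ⟨s₂, p⟩)) F ∧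
          c u = ∫ v, ∏ s₂, iteratedPartial (L s₂)
            (fun w => innerGenerator ψ₁ (ψ₂ s₂) v (tStar (ψ₂ s₂) (ψ₃ s₂) w))
            (fun p => u ⟨s₂, p⟩) ∂F) ∧
      -- explicit formula
      ∀ u ∈ openCube _,
        c u =
          (∏ s₂, ∏ s₃, ∏ s₄, deriv (genInv (ψ₃ s₂ s₃)) (u ⟨s₂, s₃, s₄⟩)) *
            ∑ k ∈ Finset.Icc d₁ (∑ s₂, ∑ s₃, d₃ s₂ s₃),
              coeffB d₃ ψ₁ ψ₂ ψ₃ k (fun s₂ => tVec (ψ₃ s₂) fun p => u ⟨s₂, p⟩) *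
                iteratedDeriv k ψ₁ (genInv ψ₁ (nestedCopula₃ ψ₁ ψ₂ ψ₃ u)) := by
  refine ⟨fun s₂ v _ => hasMixedPartialOn_innerGenerator (hd₂ s₂) (hd₃ s₂) hψ₁ (hψ₂ s₂) (hψ₃ s₂) v,
    nestedDensity d₃ ψ₁ ψ₂ ψ₃,
    isDensityOf_nestedDensity hd₁ hd₂ hd₃ hψ₁ hψ₂ hψ₃ hnode₂ hnode₃,
    hasMixedPartialOn_nestedCopula₃ hd₁ hd₂ hd₃ hψ₁ hψ₂ hψ₃,
    fun F hF L hL u hu => nestedDensity_eq_integral hd₁ hd₂ hd₃ hψ₁ hψ₂ hψ₃ hF hL hu,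
    fun u _ => rfl⟩
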